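/- Let $K$ be a field of characteristic $p\ge 0$ and $n\ge 0$ an integer. Let $\mathcal O(n|n)$ be the superalgebra of divided powers $z^{(\alpha)}$ (with unrestricted exponents $\alpha\in\mathbb Z_{\ge0}^n$) in even indeterminates $z_1,\dots,z_n$, tensored with the Grassmann algebra of odd indeterminates $\xi_1,\dots,\xi_n$; let $\mathfrak{vect}(n|n)$ be the Lie superalgebra of vector fields $\sum_i (F_i\partial_{z_i}+G_i\partial_{\xi_i})$ with $F_i,G_i\in\mathcal O(n|n)$ (for every $p$, a Lie superalgebra carries a squaring $x\mapsto x^2$ of odd elements whose polarization is the bracket of odd elements; here $X^2$ is the square of the operator $X$), $\mathbb Z$-graded by $\deg z_i=\deg\xi_i=1$. Realize $\mathfrak q(n)=\{(A,B)\mid A,B\in \mathrm{Mat}_n(K)\}$ ($A$ even, $B$ odd) in degree $0$ by $$(A,0)\mapsto\sum_{i,j}A_{ij}(z_i\partial_{z_j}+\xi_i\partial_{\xi_j}),\qquad (0,B)\mapsto\sum_{i,j}B_{ij}(z_i\partial_{\xi_j}+\xi_i\partial_{z_j}).$$ The generalized Cartan prolong $\mathfrak h=(\mathrm{id},\mathfrak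 q(n))_*=\bigoplus_{k\ge-1}\mathfrak h_k$ is given by: $\mathfrak h_{-1}$ is the span of all $\partial_{z_i},\partial_{\xi_i}$; $\mathfrak h_0$ is the image of $\mathfrak q(n)$; and for $k\ge1$, $\mathfrak h_k$ is the set of $X\in\mathfrak{vect}(n|n)$ of degree $k$ with $[\mathfrak h_{-1},X]\subset\mathfrak h_{k-1}$. 1) If $p=2$, then $\mathfrak h=\mathfrak q(\mathfrak{vect}(n;\underline N_s|0))$. Here $\mathfrak{vect}(n;\underline N_s|0)$, $\underline N_s=(1,\dots,1)$, is the restricted Witt algebra of vector fields $\sum_i f_i\partial_{z_i}$ whose coefficients are linear combinations of the $z^{(\alpha)}$ with all $\alpha_i<2$, with $2$-structure $D^{[2]}=D\circ D$ (as a derivation of the algebra of such linear combinations), and for a restricted Lie algebra $\mathfrak g$ in characteristic $2$ its queerification is $\mathfrak q(\mathfrak g)=\mathfrak g\oplus\Pi(\mathfrak g)$ with $[x,\Pi(y)]=\Pi([x,y])$ and $(\Pi(x))^2=x^{[2]}$. Precisely: there is an injective homomorphism of Lie superalgebras (preserving parity, brackets and squaring) $\mathfrak q(\mathfrak{vect}(n;\underline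 N_s|0))\to\mathfrak{vect}(n|n)$ whose image is $\mathfrak h$, which preserves the $\mathbb Z$-gradings and maps $\partial_{z_i}\mapsto\partial_{z_i}$, $\Pi(\partial_{z_i})\mapsto\partial_{\xi_i}$ for all $i$. 2) If $p\ne2$, then $\mathfrak h_k=0$ for all $k\ge1$. -/

import Mathlib

namespace QProlong

/-! ### Lie superalgebras over a field of arbitrary characteristic -/

/-- A Lie superalgebra `L₀ ⊕ L₁` over `K`, of any characteristic (including 2 and 3): `L₀` is a Lie
algebra, `L₁` is an `L₀`-module, and there is a squaring `L₁ → L₀` whose polarization is the bracket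
of odd elements (so `[x, x] = 2 x²`), subject to the Jacobi identity in the form
`[x², y] = [x, [x, y]]` for `x` odd and `y` even (`lie_sq`) or odd (`sq_lie`), and `[x², x] = 0`. -/
structure LieSuperalgebra (K L₀ L₁ : Type*) [CommRing K] [LieRing L₀] [LieAlgebra K L₀]
    [AddCommGroup L₁] [Module K L₁] [LieRingModule L₀ L₁] [LieModule K L₀ L₁] where
  sq : L₁ → L₀
  oddBracket : L₁ →ₗ[K] L₁ →ₗ[K] L₀
  sq_smul : ∀ (c : K) (x : L₁), sq (c • x) = c ^ 2 • sq x
  sq_add : ∀ x y : L₁, sq (x + y) = sq x + sq y + oddBracket x y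
  lie_sq : ∀ (a : L₀) (x : L₁), ⁅a, sq x⁆ = oddBracket ⁅a, x⁆ x
  sq_lie : ∀ x y : L₁, ⁅sq x, y⁆ = -⁅oddBracket x y, x⁆
  sq_lie_self : ∀ x : L₁, ⁅sq x, x⁆ = 0

/-- A homomorphism of Lie superalgebras: an even linear map preserving all brackets and the squaring. -/
structure LieSuperHom {K L₀ L₁ M₀ M₁ : Type*} [CommRing K]
    [LieRing L₀] [LieAlgebra K L₀] [AddCommGroup L₁] [Module K L₁]
    [LieRingModule L₀ L₁] [LieModule K L₀ L₁]
    [LieRing M₀] [LieAlgebra K M₀] [AddCommGroup M₁] [Module K M₁]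
    [LieRingModule M₀ M₁] [LieModule K M₀ M₁]
    (A : LieSuperalgebra K L₀ L₁) (B : LieSuperalgebra K M₀ M₁) where
  even : L₀ →ₗ⁅K⁆ M₀
  odd : L₁ →ₗ[K] M₁
  map_lie_odd : ∀ (a : L₀) (x : L₁), odd ⁅a, x⁆ = ⁅even a, odd x⁆
  map_sq : ∀ x : L₁, even (A.sq x) = B.sq (odd x)
  map_oddBracket : ∀ x y : L₁, even (A.oddBracket x y) = B.oddBracket (odd x) (odd y)

/-- A (classical) 2-structure on a Lie algebra of characteristic 2, `x ↦ x^[2]`. -/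
structure TwoStructure (K L : Type*) [CommRing K] [LieRing L] [LieAlgebra K L] where
  sq : L → L
  sq_smul : ∀ (c : K) (x : L), sq (c • x) = c ^ 2 • sq x
  sq_add : ∀ x y : L, sq (x + y) = sq x + sq y + ⁅x, y⁆
  sq_lie : ∀ x y : L, ⁅sq x, y⁆ = ⁅x, ⁅x, y⁆⁆

theorem neg_eq_self_of_char_two (K : Type*) {M : Type*} [CommRing K] [CharP K 2]
    [AddCommGroup M] [Module K M] (x : M) : -x = x := by
  have h : (-1 : K) = 1 := by simp [CharTwo.neg_eq]
  calc -x = (-1 : K) • x := by simp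
    _ = x := by rw [h, one_smul]

/-- Queerification of a restricted Lie algebra `L` in characteristic 2: the Lie superalgebra
`q(L) = L ⊕ Π(L)` with `[x, Π y] = Π [x, y]` and `(Π x)² = x^[2]`.
The second copy of `L` in the type is the odd part `Π(L)`, with the adjoint action of `L`. -/
def queerification {K L : Type*} [CommRing K] [CharP K 2] [LieRing L] [LieAlgebra K L]
    (s : TwoStructure K L) : LieSuperalgebra K L L where
  sq := s.sq
  oddBracket := LinearMap.mk₂ K (fun x y => ⁅x, y⁆) add_lie smul_lie lie_add lie_smul
  sq_smul := s.sq_smul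
  sq_add := s.sq_add
  lie_sq := fun a x => by
    change ⁅a, s.sq x⁆ = ⁅⁅a, x⁆, x⁆
    rw [← lie_skew, s.sq_lie, ← lie_skew a x, ← lie_skew (-⁅x, a⁆) x, lie_neg, neg_neg,
      neg_eq_self_of_char_two K]
  sq_lie := fun x y => by
    change ⁅s.sq x, y⁆ = -⁅⁅x, y⁆, x⁆
    rw [s.sq_lie, lie_skew]
  sq_lie_self := fun x => by rw [s.sq_lie, lie_self, lie_zero]

/-! ### The divided power superalgebra `O(a|b)` -/

/-- The pair `(α, S)` stands for the monomial `z^(α) ξ_S`, where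
`z^(α) = z₁^(α₁) ⋯ z_a^(α_a)` is a product of divided powers and `ξ_S` is the product of the odd
indeterminates `ξ_s`, `s ∈ S`, in increasing order. -/
abbrev Mon (a b : ℕ) : Type := (Fin a → ℕ) × Finset (Fin b)

/-- The superalgebra `O(a|b)` of divided powers in `a` even indeterminates, with no bound on the
exponents, and `b` odd ones, as a space: linear combinations of monomials. (If `char K = 0` it is
`K[z] ⊗ Λ(ξ)`.) Its product is `dmul`, not the pointwise product of coefficients. -/
abbrev DPow (K : Type*) [Field K] (a b : ℕ) : Type _ := Mon a b →₀ K

/-- For disjoint `S` and `T`, the sign in `ξ_S ξ_T = ± ξ_{S ∪ T}`. -/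
def sgn (K : Type*) [Field K] {b : ℕ} (S T : Finset (Fin b)) : K :=
  ∏ s ∈ S, ∏ t ∈ T, if t < s then -1 else 1

/-- The coefficient in `z^(α) z^(β) = binom α β • z^(α + β)`. -/
def binom {a : ℕ} (α β : Fin a → ℕ) : ℕ := ∏ i, (α i + β i).choose (α i)

/-- `z^(α) ξ_S · z^(β) ξ_T` is `mulCoeff` times the monomial `mulMon`; it is `0` if `S`, `T` intersect. -/
def mulCoeff (K : Type*) [Field K] {a b : ℕ} (x y : Mon a b) : K :=
  if Disjoint x.2 y.2 then (binom x.1 y.1 : K) * sgn K x.2 y.2 else 0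

def mulMon {a b : ℕ} (x y : Mon a b) : Mon a b := (x.1 + y.1, x.2 ∪ y.2)

/-- `∂_i` of a monomial is `derCoeff` times the monomial `derMon`:
`∂_{z_i} z_i^(k) = z_i^(k-1)`, and `∂_{ξ_j}` is the left derivative. Here `Sum.inl i` is the index of
`z_i` and `Sum.inr j` the index of `ξ_j`. -/
def derCoeff (K : Type*) [Field K] {a b : ℕ} : Fin a ⊕ Fin b → Mon a b → K
  | .inl i, x => if x.1 i = 0 then 0 else 1
  | .inr j, x => if j ∈ x.2 then sgn K {j} x.2 else 0

def derMon {a b : ℕ} : Fin a ⊕ Fin b → Mon a b → Mon a b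
  | .inl i, x => (x.1 - Pi.single i 1, x.2)
  | .inr j, x => (x.1, x.2.erase j)

section
variable (K : Type*) [Field K] (a b : ℕ)

/-- The product of `O(a|b)`. -/
noncomputable def dmul : DPow K a b →ₗ[K] DPow K a b →ₗ[K] DPow K a b :=
  Finsupp.lsum K fun x => LinearMap.toSpanSingleton K _
    (Finsupp.lsum K fun y => LinearMap.toSpanSingleton K _
      (Finsupp.single (mulMon x y) (mulCoeff K x y)))

/-- The partial derivatives `∂_{z_i}`, `∂_{ξ_j}` on `O(a|b)`. -/
noncomputable def pderiv (i : Fin a ⊕ Fin b) : DPow K a b →ₗ[K] DPow K a b :=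
  Finsupp.lsum K fun x => LinearMap.toSpanSingleton K _
    (Finsupp.single (derMon i x) (derCoeff K i x))

end

section
variable {K : Type*} [Field K] {a b : ℕ}

theorem dmul_single (x y : Mon a b) (c d : K) :
    dmul K a b (Finsupp.single x c) (Finsupp.single y d) =
      Finsupp.single (mulMon x y) (c * d * mulCoeff K x y) := by
  rw [dmul, Finsupp.lsum_single, LinearMap.toSpanSingleton_apply, LinearMap.smul_apply,
    Finsupp.lsum_single, LinearMap.toSpanSingleton_apply, Finsupp.smul_single,
    Finsupp.smul_single, smul_eq_mul, smul_eq_mul, mul_assoc]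

theorem pderiv_single (i : Fin a ⊕ Fin b) (x : Mon a b) (c : K) :
    pderiv K a b i (Finsupp.single x c) = Finsupp.single (derMon i x) (c * derCoeff K i x) := by
  rw [pderiv, Finsupp.lsum_single, LinearMap.toSpanSingleton_apply, Finsupp.smul_single,
    smul_eq_mul]

theorem sgn_union_left {S T U : Finset (Fin b)} (h : Disjoint S T) :
    sgn K (S ∪ T) U = sgn K S U * sgn K T U := by
  simp [sgn, Finset.prod_union h]

theorem sgn_union_right {S T U : Finset (Fin b)} (h : Disjoint T U) :
    sgn K S (T ∪ U) = sgn K S T * sgn K S U := by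
  simp [sgn, Finset.prod_union h, Finset.prod_mul_distrib]

theorem sgn_mul_self (S T : Finset (Fin b)) : sgn K S T * sgn K S T = 1 := by
  rw [sgn, ← Finset.prod_mul_distrib]
  refine Finset.prod_eq_one fun s _ => ?_
  rw [← Finset.prod_mul_distrib]
  refine Finset.prod_eq_one fun t _ => ?_
  split_ifs <;> simp

theorem sgn_mul_swap {S T : Finset (Fin b)} (h : Disjoint S T) :
    sgn K S T * sgn K T S = (-1) ^ (S.card * T.card) := by
  have h2 : sgn K T S = ∏ s ∈ S, ∏ t ∈ T, if s < t then (-1 : K) else 1 := by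
    rw [sgn, Finset.prod_comm]
  rw [h2, sgn, ← Finset.prod_mul_distrib]
  have : ∀ s ∈ S, ((∏ t ∈ T, if t < s then (-1 : K) else 1) * ∏ t ∈ T, if s < t then -1 else 1)
      = (-1) ^ T.card := by
    intro s hs
    rw [← Finset.prod_mul_distrib, ← Finset.prod_const]
    refine Finset.prod_congr rfl fun t ht => ?_
    have : s ≠ t := fun e => (Finset.disjoint_left.1 h hs) (e ▸ ht)
    rcases lt_or_gt_of_ne this with h | h <;> simp [h, h.not_gt]
  rw [Finset.prod_congr rfl this, Finset.prod_const, ← pow_mul, mul_comm]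

theorem binom_assoc (α β γ : Fin a → ℕ) :
    binom α β * binom (α + β) γ = binom β γ * binom α (β + γ) := by
  simp only [binom, ← Finset.prod_mul_distrib]
  refine Finset.prod_congr rfl fun i _ => ?_
  have h := Nat.choose_mul (n := α i + β i + γ i) (k := α i + β i) (s := α i) (by omega)
  have e1 : α i + β i + γ i - α i = β i + γ i := by omega
  have e2 : α i + β i - α i = β i := by omega
  rw [e1, e2] at h
  simp only [Pi.add_apply, ← add_assoc]
  rw [mul_comm, h, mul_comm]

theorem binom_comm (α β : Fin a → ℕ) : binom α β = binom β α := by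
  simp only [binom]
  refine Finset.prod_congr rfl fun i _ => ?_
  rw [Nat.choose_symm_add, add_comm]

theorem mulCoeff_assoc (x y z : Mon a b) :
    mulCoeff K x y * mulCoeff K (mulMon x y) z = mulCoeff K y z * mulCoeff K x (mulMon y z) := by
  obtain ⟨α, S⟩ := x
  obtain ⟨β, T⟩ := y
  obtain ⟨γ, U⟩ := z
  simp only [mulCoeff, mulMon, Finset.disjoint_union_left, Finset.disjoint_union_right]
  by_cases h1 : Disjoint S T <;> by_cases h2 : Disjoint T U <;> by_cases h3 : Disjoint S U <;>
    simp only [h1, h2, h3, and_self, and_true, and_false, if_true, if_false, mul_zero, zero_mul]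
  have hb : (binom α β : K) * binom (α + β) γ = binom β γ * binom α (β + γ) := by
    rw [← Nat.cast_mul, ← Nat.cast_mul, binom_assoc]
  rw [sgn_union_left h1, sgn_union_right h2]
  linear_combination (sgn K S T * sgn K S U * sgn K T U) * hb

theorem dmul_assoc (f g h : DPow K a b) :
    dmul K a b (dmul K a b f g) h = dmul K a b f (dmul K a b g h) := by
  induction f using Finsupp.induction_linear with
  | zero => simp
  | add f₁ f₂ h₁ h₂ => simp [h₁, h₂]
  | single x c =>
  induction g using Finsupp.induction_linear with
  | zero => simp
  | add f₁ f₂ h₁ h₂ => simp [h₁, h₂]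
  | single y d =>
  induction h using Finsupp.induction_linear with
  | zero => simp
  | add f₁ f₂ h₁ h₂ => simp [h₁, h₂]
  | single z e =>
  simp only [dmul_single]
  congr 1
  · simp [mulMon, add_assoc, Finset.union_assoc]
  · linear_combination (c * d * e) * mulCoeff_assoc (K := K) x y z

/-- The unit of `O(a|b)`. -/
noncomputable def dpOne : DPow K a b := Finsupp.single (0, ∅) 1

theorem dmul_one (f : DPow K a b) : dmul K a b f dpOne = f := by
  induction f using Finsupp.induction_linear with
  | zero => simp
  | add f₁ f₂ h₁ h₂ => simp [h₁, h₂]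
  | single x c =>
  rw [dpOne, dmul_single]
  simp [mulMon, mulCoeff, binom, sgn]

/-! ### Parity -/
/-- The sign `(-1)^(st)` for parities `s`, `t`. -/
def ksign (K : Type*) [Field K] (s t : ZMod 2) : K := if s = 1 ∧ t = 1 then -1 else 1

/-- The homogeneous elements of `O(a|b)` of parity `s`. -/
def dpPar (K : Type*) [Field K] (a b : ℕ) (s : ZMod 2) : Submodule K (DPow K a b) :=
  Finsupp.supported K K {x : Mon a b | (x.2.card : ZMod 2) = s}

theorem dpPar_induction {s : ZMod 2} {P : (f : DPow K a b) → f ∈ dpPar K a b s → Prop}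
    (h0 : P 0 (Submodule.zero_mem _))
    (hadd : ∀ f g (hf : f ∈ dpPar K a b s) (hg : g ∈ dpPar K a b s), P f hf → P g hg →
      P (f + g) (Submodule.add_mem _ hf hg))
    (hs : ∀ (x : Mon a b) (c : K) (hx : (x.2.card : ZMod 2) = s),
      P (Finsupp.single x c) (Finsupp.single_mem_supported K c hx))
    (f : DPow K a b) (hf : f ∈ dpPar K a b s) : P f hf := by
  induction f using Finsupp.induction with
  | zero => exact h0
  | single_add x c f hx hc ih =>
    have h1 : (x.2.card : ZMod 2) = s := by
      apply hf
      simp [Finsupp.mem_support_iff, Finsupp.notMem_support_iff.1 hx, hc]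
    have h2 : Finsupp.single x c ∈ dpPar K a b s := Finsupp.single_mem_supported K c h1
    have h3 : f ∈ dpPar K a b s := by
      have := Submodule.sub_mem _ hf h2
      rwa [add_sub_cancel_left] at this
    exact hadd _ _ h2 h3 (hs x c h1) (ih h3)

theorem ksign_card (m n : ℕ) : ksign K (m : ZMod 2) (n : ZMod 2) = (-1) ^ (m * n) := by
  simp only [ksign, ZMod.natCast_eq_one_iff_odd]
  split_ifs with h
  · exact (Odd.neg_one_pow (h.1.mul h.2)).symm
  · rw [not_and_or, Nat.not_odd_iff_even, Nat.not_odd_iff_even] at h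
    exact (Even.neg_one_pow (h.elim (·.mul_right _) (·.mul_left _))).symm

theorem dmul_comm {s t : ZMod 2} {f g : DPow K a b} (hf : f ∈ dpPar K a b s)
    (hg : g ∈ dpPar K a b t) : dmul K a b f g = ksign K s t • dmul K a b g f := by
  induction f, hf using dpPar_induction with
  | h0 => simp
  | hadd f₁ f₂ _ _ h₁ h₂ => simp [h₁, h₂]
  | hs x c hx =>
  induction g, hg using dpPar_induction with
  | h0 => simp
  | hadd f₁ f₂ _ _ h₁ h₂ => simp [h₁, h₂]
  | hs y d hy =>
  rw [dmul_single, dmul_single, Finsupp.smul_single, ← hx, ← hy, ksign_card, smul_eq_mul]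
  congr 1
  · simp [mulMon, add_comm, Finset.union_comm]
  · simp only [mulCoeff, disjoint_comm (a := y.2)]
    split_ifs with h
    · have h1 := sgn_mul_swap (K := K) h
      have h2 := sgn_mul_self (K := K) y.2 x.2
      rw [binom_comm y.1 x.1, ← h1]
      linear_combination (-c * d * binom x.1 y.1 * sgn K x.2 y.2) * h2
    · simp

theorem dmul_self_odd {f : DPow K a b} (hf : f ∈ dpPar K a b 1) : dmul K a b f f = 0 := by
  induction f, hf using dpPar_induction with
  | h0 => simp
  | hadd f g hf hg h₁ h₂ =>
    have := dmul_comm hf hg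
    simp [h₁, h₂, this, ksign]
  | hs x c hx =>
    have : ¬ Disjoint x.2 x.2 := by
      rw [disjoint_self]
      intro h
      rw [Finset.bot_eq_empty] at h
      simp [h] at hx
    rw [dmul_single, mulCoeff, if_neg this, mul_zero, Finsupp.single_zero]

theorem dmul_mem_par {s t : ZMod 2} {f g : DPow K a b} (hf : f ∈ dpPar K a b s)
    (hg : g ∈ dpPar K a b t) : dmul K a b f g ∈ dpPar K a b (s + t) := by
  induction f, hf using dpPar_induction with
  | h0 => simp
  | hadd f₁ f₂ _ _ h₁ h₂ => simpa using Submodule.add_mem _ h₁ h₂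
  | hs x c hx =>
  induction g, hg using dpPar_induction with
  | h0 => simp
  | hadd f₁ f₂ _ _ h₁ h₂ => simpa using Submodule.add_mem _ h₁ h₂
  | hs y d hy =>
  rw [dmul_single]
  by_cases h : Disjoint x.2 y.2
  · apply Finsupp.single_mem_supported
    simp [mulMon, Finset.card_union_of_disjoint h, hx, hy]
  · simp [mulCoeff, h]

/-- The parity of an indeterminate. -/
def varPar {a b : ℕ} : Fin a ⊕ Fin b → ZMod 2
  | .inl _ => 0
  | .inr _ => 1

theorem pderiv_mem_par {s : ZMod 2} {f : DPow K a b} (hf : f ∈ dpPar K a b s)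
    (i : Fin a ⊕ Fin b) : pderiv K a b i f ∈ dpPar K a b (s + varPar i) := by
  induction f, hf using dpPar_induction with
  | h0 => simp
  | hadd f₁ f₂ _ _ h₁ h₂ => simpa using Submodule.add_mem _ h₁ h₂
  | hs x c hx =>
  rw [pderiv_single]
  rcases i with i | j
  · apply Finsupp.single_mem_supported
    simp [derMon, varPar, hx]
  · by_cases h : j ∈ x.2
    · apply Finsupp.single_mem_supported
      have h1 : (x.2.erase j).card + 1 = x.2.card := Finset.card_erase_add_one h
      have h2 : ((x.2.erase j).card : ZMod 2) + 1 = s := by rw [← hx, ← h1]; push_cast; rfl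
      simp only [derMon, varPar, Set.mem_ofPred_eq, ← h2, add_assoc]
      rw [show (1 : ZMod 2) + 1 = 0 from rfl, add_zero]
    · simp [derCoeff, h]

theorem sgn_erase {S : Finset (Fin b)} {i j : Fin b} (h : i ∈ S) :
    sgn K {j} S = sgn K {j} {i} * sgn K {j} (S.erase i) := by
  rw [← sgn_union_right (by simp), ← Finset.insert_eq, Finset.insert_erase h]

theorem pderiv_comm (i j : Fin a ⊕ Fin b) (f : DPow K a b) :
    pderiv K a b i (pderiv K a b j f) =
      ksign K (varPar i) (varPar j) • pderiv K a b j (pderiv K a b i f) := by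
  induction f using Finsupp.induction_linear with
  | zero => simp
  | add f₁ f₂ h₁ h₂ => simp [h₁, h₂]
  | single x c =>
  obtain ⟨α, S⟩ := x
  simp only [pderiv_single, Finsupp.smul_single]
  rcases i with i | i <;> rcases j with j | j
  · by_cases hij : i = j
    · subst hij; simp [ksign, varPar]
    · simp [derMon, derCoeff, ksign, varPar, hij, Ne.symm hij, tsub_right_comm,
        -mul_ite, mul_right_comm c]
  · by_cases hi : α i = 0 <;> by_cases hj : j ∈ S <;>
      simp [derMon, derCoeff, ksign, varPar, hi, hj]
  · by_cases hi : i ∈ S <;> by_cases hj : α j = 0 <;>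
      simp [derMon, derCoeff, ksign, varPar, hi, hj]
  · by_cases hij : i = j
    · subst hij; simp [derMon, derCoeff]
    · simp only [derMon, derCoeff, ksign, varPar, Finset.mem_erase, ne_eq, hij, Ne.symm hij,
        not_false_eq_true, true_and, and_self, if_true, Finset.erase_right_comm (a := i) (b := j)]
      congr 1
      by_cases hi : i ∈ S <;> by_cases hj : j ∈ S <;> simp only [hi, hj, if_true, if_false,
        mul_zero, zero_mul, smul_zero]
      have h1 := sgn_mul_swap (K := K) (S := {i}) (T := {j}) (by simpa using hij)
      simp only [Finset.card_singleton, mul_one, pow_one] at h1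
      have h2 := sgn_mul_self (K := K) {i} {j}
      rw [sgn_erase (j := j) hi, sgn_erase (j := i) hj, smul_eq_mul]
      linear_combination (-c * sgn K {j} {i} * sgn K {j} (S.erase i) * sgn K {i} (S.erase j)) * h2
        + (c * sgn K {i} {j} * sgn K {j} (S.erase i) * sgn K {i} (S.erase j)) * h1

theorem pderiv_odd_sq (j : Fin b) (f : DPow K a b) :
    pderiv K a b (.inr j) (pderiv K a b (.inr j) f) = 0 := by
  induction f using Finsupp.induction_linear with
  | zero => simp
  | add f₁ f₂ h₁ h₂ => simp [h₁, h₂]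
  | single x c => simp [pderiv_single, derCoeff, derMon]

theorem binom_split (i : Fin a) (α β : Fin a → ℕ) : binom α β =
    (α i + β i).choose (α i) * ∏ k ∈ Finset.univ.erase i, (α k + β k).choose (α k) :=
  (Finset.mul_prod_erase _ _ (Finset.mem_univ i)).symm

theorem binom_sub_left (i : Fin a) (α β : Fin a → ℕ) : binom (α - Pi.single i 1) β =
    (α i - 1 + β i).choose (α i - 1) * ∏ k ∈ Finset.univ.erase i, (α k + β k).choose (α k) := by
  rw [binom_split i]
  congr 1
  · simp
  · refine Finset.prod_congr rfl fun k hk => ?_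
    simp [Finset.ne_of_mem_erase hk]

theorem binom_sub_right (i : Fin a) (α β : Fin a → ℕ) : binom α (β - Pi.single i 1) =
    (α i + (β i - 1)).choose (α i) * ∏ k ∈ Finset.univ.erase i, (α k + β k).choose (α k) := by
  rw [binom_split i]
  congr 1
  · simp
  · refine Finset.prod_congr rfl fun k hk => ?_
    simp [Finset.ne_of_mem_erase hk]

theorem pderiv_dmul_single_inl (i : Fin a) (x y : Mon a b) (c d : K) :
    pderiv K a b (.inl i) (dmul K a b (Finsupp.single x c) (Finsupp.single y d)) =
      dmul K a b (pderiv K a b (.inl i) (Finsupp.single x c)) (Finsupp.single y d) +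
      dmul K a b (Finsupp.single x c) (pderiv K a b (.inl i) (Finsupp.single y d)) := by
  obtain ⟨α, S⟩ := x
  obtain ⟨β, T⟩ := y
  simp only [pderiv_single, dmul_single, mulMon, derMon, derCoeff, mulCoeff]
  by_cases hd : Disjoint S T <;> simp only [hd, if_true, if_false]
  swap
  · simp
  have m1 : α i ≠ 0 → α - Pi.single i 1 + β = α + β - Pi.single i 1 := by
    intro h; ext k
    by_cases hk : k = i
    · subst hk; simp; omega
    · simp [hk]
  have m2 : β i ≠ 0 → α + (β - Pi.single i 1) = α + β - Pi.single i 1 := by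
    intro h; ext k
    by_cases hk : k = i
    · subst hk; simp; omega
    · simp [hk]
  rw [binom_sub_left, binom_sub_right, binom_split i α β]
  by_cases h1 : α i = 0 <;> by_cases h2 : β i = 0
  · simp [h1, h2]
  · simp [h1, h2, m2]
  · simp [h1, h2, m1]
  · rw [m1 h1, m2 h2, ← Finsupp.single_add]
    congr 1
    obtain ⟨u, hu⟩ := Nat.exists_eq_succ_of_ne_zero h1
    obtain ⟨v, hv⟩ := Nat.exists_eq_succ_of_ne_zero h2
    have hp : ((u + 1 + (v + 1)).choose (u + 1) : K) =
        (u + (v + 1)).choose u + (u + 1 + v).choose (u + 1) := by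
      rw [show u + 1 + (v + 1) = (u + (v + 1)) + 1 by ring, Nat.choose_succ_succ,
        show u + (v + 1) = u + 1 + v by ring, Nat.cast_add]
    simp only [Pi.add_apply, hu, hv, Nat.succ_eq_add_one, Nat.add_sub_cancel, Nat.cast_mul, hp]
    simp
    ring

theorem sgn_singleton_self (j : Fin b) : sgn K {j} {j} = 1 := by simp [sgn]

theorem pderiv_dmul_single_inr (j : Fin b) (x y : Mon a b) (c d : K) :
    pderiv K a b (.inr j) (dmul K a b (Finsupp.single x c) (Finsupp.single y d)) =
      dmul K a b (pderiv K a b (.inr j) (Finsupp.single x c)) (Finsupp.single y d) +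
      (-1 : K) ^ x.2.card •
        dmul K a b (Finsupp.single x c) (pderiv K a b (.inr j) (Finsupp.single y d)) := by
  obtain ⟨α, S⟩ := x
  obtain ⟨β, T⟩ := y
  simp only [pderiv_single, dmul_single, mulMon, derMon, derCoeff, mulCoeff, Finsupp.smul_single,
    smul_eq_mul]
  by_cases hS : j ∈ S <;> by_cases hT : j ∈ T
  · obtain ⟨S', hS', rfl⟩ : ∃ S', j ∉ S' ∧ S = insert j S' :=
      ⟨S.erase j, by simp, (Finset.insert_erase hS).symm⟩
    obtain ⟨T', hT', rfl⟩ : ∃ T', j ∉ T' ∧ T = insert j T' :=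
      ⟨T.erase j, by simp, (Finset.insert_erase hT).symm⟩
    have hnd : ¬ Disjoint (insert j S') (insert j T') := by simp
    have e1 : Disjoint S' (insert j T') ↔ Disjoint S' T' := by simp [hS']
    have e2 : Disjoint (insert j S') T' ↔ Disjoint S' T' := by simp [hT']
    simp only [hnd, hS, hT, if_true, if_false, Finset.erase_insert hS', Finset.erase_insert hT',
      e1, e2, Finset.insert_union, Finset.union_insert, mul_zero, zero_mul, Finsupp.single_zero,
      ← Finsupp.single_add, Finset.card_insert_of_notMem hS']
    by_cases hd : Disjoint S' T' <;> simp only [hd, if_true, if_false]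
    swap
    · simp
    have dS : Disjoint {j} S' := by simpa using hS'
    have dT : Disjoint {j} T' := by simpa using hT'
    have h1 := sgn_mul_swap (K := K) dS
    have h2 := sgn_mul_self (K := K) {j} T'
    symm
    rw [Finsupp.single_eq_zero, Finset.insert_eq j S', Finset.insert_eq j T', sgn_union_right dT,
      sgn_union_right dS, sgn_union_right dT, sgn_union_left dS, sgn_singleton_self]
    rw [Finset.card_singleton, one_mul] at h1
    rw [pow_succ]
    linear_combination (c * d * binom α β * sgn K S' T') * h1 -
      (c * d * binom α β * sgn K S' T' * (-1) ^ S'.card) * h2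
  · obtain ⟨S', hS', rfl⟩ : ∃ S', j ∉ S' ∧ S = insert j S' :=
      ⟨S.erase j, by simp, (Finset.insert_erase hS).symm⟩
    have e2 : Disjoint (insert j S') T ↔ Disjoint S' T := by simp [hT]
    simp only [hS, hT, if_true, if_false, Finset.erase_insert hS', e2, mul_zero, zero_mul,
      Finsupp.single_zero, add_zero, Finset.insert_union]
    by_cases hd : Disjoint S' T <;> simp only [hd, if_true, if_false]
    swap
    · simp
    have hu : j ∉ S' ∪ T := by simp [hS', hT]
    rw [if_pos (Finset.mem_insert_self _ _)]
    rw [Finset.erase_insert hu]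
    congr 1
    have dS : Disjoint {j} S' := by simpa using hS'
    have dT : Disjoint {j} T := by simpa using hT
    have dST : Disjoint {j} (S' ∪ T) := by simpa using hu
    have h2 := sgn_mul_self (K := K) {j} T
    rw [Finset.insert_eq, Finset.insert_eq, sgn_union_right dST, sgn_union_right hd,
      sgn_union_left dS, sgn_union_right dS, sgn_singleton_self]
    linear_combination (c * d * binom α β * sgn K S' T * sgn K {j} S') * h2
  · obtain ⟨T', hT', rfl⟩ : ∃ T', j ∉ T' ∧ T = insert j T' :=
      ⟨T.erase j, by simp, (Finset.insert_erase hT).symm⟩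
    have e2 : Disjoint S (insert j T') ↔ Disjoint S T' := by simp [hS]
    simp only [hS, hT, if_true, if_false, Finset.erase_insert hT', e2, mul_zero, zero_mul,
      Finsupp.single_zero, zero_add, Finset.union_insert]
    by_cases hd : Disjoint S T' <;> simp only [hd, if_true, if_false]
    swap
    · simp
    have hu : j ∉ S ∪ T' := by simp [hS, hT']
    rw [if_pos (Finset.mem_insert_self _ _)]
    rw [Finset.erase_insert hu]
    congr 1
    have dS : Disjoint {j} S := by simpa using hS
    have dT : Disjoint {j} T' := by simpa using hT'
    have dST : Disjoint {j} (S ∪ T') := by simpa using hu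
    have h1 := sgn_mul_swap (K := K) dS
    rw [Finset.card_singleton, one_mul] at h1
    rw [Finset.insert_eq, Finset.insert_eq, sgn_union_right dST, sgn_union_right hd,
      sgn_union_right dT, sgn_union_right dT, sgn_singleton_self]
    linear_combination (c * d * binom α β * sgn K S T' * sgn K {j} T') * h1
  · simp [hS, hT]

theorem pderiv_dmul (i : Fin a ⊕ Fin b) {s : ZMod 2} {f : DPow K a b} (hf : f ∈ dpPar K a b s)
    (g : DPow K a b) :
    pderiv K a b i (dmul K a b f g) = dmul K a b (pderiv K a b i f) g +
      ksign K (varPar i) s • dmul K a b f (pderiv K a b i g) := by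
  induction f, hf using dpPar_induction with
  | h0 => simp
  | hadd f₁ f₂ _ _ h₁ h₂ => simp only [map_add, LinearMap.add_apply, h₁, h₂, smul_add]; abel
  | hs x c hx =>
  induction g using Finsupp.induction_linear with
  | zero => simp
  | add f₁ f₂ h₁ h₂ => simp only [map_add, h₁, h₂, smul_add]; abel
  | single y d =>
  rcases i with i | j
  · simp [pderiv_dmul_single_inl, ksign, varPar]
  · rw [pderiv_dmul_single_inr, ← hx, varPar]
    have := ksign_card (K := K) 1 x.2.card
    rw [Nat.cast_one, one_mul] at this
    rw [this]

/-! ### Vector fields and the Lie superalgebra `vect(a|b)` -/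

/-- Vector fields `X = ∑ X_i ∂_i` with coefficients in `O(a|b)`, the sum over all indeterminates. -/
abbrev VField (K : Type*) [Field K] (a b : ℕ) : Type _ := Fin a ⊕ Fin b → DPow K a b

/-- The action `f ↦ X(f) = ∑ X_i ∂_i f` of a vector field on functions. -/
noncomputable def vact : VField K a b →ₗ[K] Module.End K (DPow K a b) where
  toFun X := ∑ i, (dmul K a b (X i)) ∘ₗ pderiv K a b i
  map_add' X Y := by
    rw [← Finset.sum_add_distrib]
    exact Finset.sum_congr rfl fun i _ => by rw [Pi.add_apply, map_add, LinearMap.add_comp]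
  map_smul' c X := by
    rw [RingHom.id_apply, Finset.smul_sum]
    exact Finset.sum_congr rfl fun i _ => by rw [Pi.smul_apply, map_smul, LinearMap.smul_comp]

theorem vact_apply (X : VField K a b) (f : DPow K a b) :
    vact X f = ∑ i, dmul K a b (X i) (pderiv K a b i f) := by
  simp [vact, LinearMap.sum_apply]

/-- `X ▹ Y = ∑ X(Y_k) ∂_k`. -/
noncomputable def vmul : VField K a b →ₗ[K] VField K a b →ₗ[K] VField K a b :=
  LinearMap.mk₂ K (fun X Y k => vact X (Y k))
    (fun X Y Z => by ext1 k; simp)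
    (fun c X Y => by ext1 k; simp)
    (fun X Y Z => by ext1 k; simp)
    (fun c X Y => by ext1 k; simp)

theorem vmul_apply (X Y : VField K a b) (k) : vmul X Y k = vact X (Y k) := rfl

/-- The superbracket `[X, Y] = ∑ (X(Y_k) - (-1)^(st) Y(X_k)) ∂_k` of `X` of parity `s` and `Y` of
parity `t`. -/
noncomputable def vbr (s t : ZMod 2) : VField K a b →ₗ[K] VField K a b →ₗ[K] VField K a b :=
  LinearMap.mk₂ K (fun X Y => vmul X Y - ksign K s t • vmul Y X)
    (fun X Y Z => by simp only [map_add, LinearMap.add_apply, smul_add]; abel)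
    (fun c X Y => by simp only [map_smul, LinearMap.smul_apply, smul_sub, smul_comm c])
    (fun X Y Z => by simp only [map_add, LinearMap.add_apply, smul_add]; abel)
    (fun c X Y => by simp only [map_smul, LinearMap.smul_apply, smul_sub, smul_comm c])

theorem vbr_apply (s t : ZMod 2) (X Y : VField K a b) :
    vbr s t X Y = vmul X Y - ksign K s t • vmul Y X := rfl

/-- The vector fields of parity `s`. -/
noncomputable def vPar (K : Type*) [Field K] (a b : ℕ) (s : ZMod 2) : Submodule K (VField K a b) :=
  Submodule.pi Set.univ fun i => dpPar K a b (s + varPar i)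

theorem mem_vPar {s : ZMod 2} {X : VField K a b} :
    X ∈ vPar K a b s ↔ ∀ i, X i ∈ dpPar K a b (s + varPar i) := by
  simp [vPar, Submodule.mem_pi]

theorem vact_mem_par {s t : ZMod 2} {X : VField K a b} {f : DPow K a b} (hX : X ∈ vPar K a b s)
    (hf : f ∈ dpPar K a b t) : vact X f ∈ dpPar K a b (s + t) := by
  rw [vact_apply]
  refine Submodule.sum_mem _ fun i _ => ?_
  have := dmul_mem_par (mem_vPar.1 hX i) (pderiv_mem_par hf i)
  have e : s + varPar i + (t + varPar i) = s + t := by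
    rw [show s + varPar i + (t + varPar i) = s + t + (varPar i + varPar i) by ring,
      CharTwo.add_self_eq_zero, add_zero]
  rwa [e] at this

theorem vmul_mem_par {s t u : ZMod 2} {X Y : VField K a b} (hX : X ∈ vPar K a b s)
    (hY : Y ∈ vPar K a b t) (hu : s + t = u) : vmul X Y ∈ vPar K a b u := by
  subst hu
  rw [mem_vPar] at hY ⊢
  intro i
  rw [add_assoc]
  exact vact_mem_par hX (hY i)

theorem vbr_mem_par {s t u : ZMod 2} {X Y : VField K a b} (hX : X ∈ vPar K a b s)
    (hY : Y ∈ vPar K a b t) (hu : s + t = u) : vbr s t X Y ∈ vPar K a b u :=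
  Submodule.sub_mem _ (vmul_mem_par hX hY hu)
    (Submodule.smul_mem _ _ (vmul_mem_par hY hX (by rw [add_comm, hu])))

theorem one_add_one_zmod : (1 : ZMod 2) + 1 = 0 := rfl

theorem zmod_two_cases (s : ZMod 2) : s = 0 ∨ s = 1 := by
  revert s; decide

theorem vact_dmul {s t : ZMod 2} {X : VField K a b} {f : DPow K a b} (hX : X ∈ vPar K a b s)
    (hf : f ∈ dpPar K a b t) (g : DPow K a b) :
    vact X (dmul K a b f g) =
      dmul K a b (vact X f) g + ksign K s t • dmul K a b f (vact X g) := by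
  simp only [vact_apply, map_sum, LinearMap.sum_apply, Finset.smul_sum]
  rw [← Finset.sum_add_distrib]
  refine Finset.sum_congr rfl fun i _ => ?_
  rw [pderiv_dmul i hf, map_add, map_smul, ← dmul_assoc, ← dmul_assoc, ← dmul_assoc,
    dmul_comm (mem_vPar.1 hX i) hf, map_smul, LinearMap.smul_apply, smul_smul]
  congr 2
  rcases zmod_two_cases s with rfl | rfl <;> rcases zmod_two_cases t with rfl | rfl <;>
    rcases zmod_two_cases (varPar i) with h | h <;> simp [h, ksign, CharTwo.add_self_eq_zero]

/-- The second-order part of the composition of two vector fields. -/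
noncomputable def vsecond (s t : ZMod 2) (X Y : VField K a b) (f : DPow K a b) : DPow K a b :=
  ∑ j, ∑ i, ksign K s (t + varPar j) •
    dmul K a b (Y j) (dmul K a b (X i) (pderiv K a b i (pderiv K a b j f)))

theorem vact_vact {s t : ZMod 2} {X Y : VField K a b} (hX : X ∈ vPar K a b s)
    (hY : Y ∈ vPar K a b t) (f : DPow K a b) :
    vact X (vact Y f) = vact (vmul X Y) f + vsecond s t X Y f := by
  rw [vact_apply Y, map_sum, vact_apply (vmul X Y), vsecond, ← Finset.sum_add_distrib]
  refine Finset.sum_congr rfl fun j _ => ?_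
  rw [vact_dmul hX (mem_vPar.1 hY j), vmul_apply, vact_apply X (pderiv K a b j f), map_sum,
    Finset.smul_sum]

theorem vsecond_term {s t : ZMod 2} {X Y : VField K a b} (hX : X ∈ vPar K a b s)
    (hY : Y ∈ vPar K a b t) (f : DPow K a b) (i j : Fin a ⊕ Fin b) :
    ksign K s (t + varPar j) •
      dmul K a b (Y j) (dmul K a b (X i) (pderiv K a b i (pderiv K a b j f))) =
    ksign K s t • ksign K t (s + varPar i) •
      dmul K a b (X i) (dmul K a b (Y j) (pderiv K a b j (pderiv K a b i f))) := by
  rw [← dmul_assoc, ← dmul_assoc, pderiv_comm i j, dmul_comm (mem_vPar.1 hY j) (mem_vPar.1 hX i),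
    map_smul, map_smul, LinearMap.smul_apply, smul_smul, smul_smul, smul_smul]
  congr 1
  rcases zmod_two_cases s with rfl | rfl <;> rcases zmod_two_cases t with rfl | rfl <;>
    rcases zmod_two_cases (varPar i) with h | h <;>
    rcases zmod_two_cases (varPar j) with h' | h' <;>
    simp [h, h', ksign, CharTwo.add_self_eq_zero]

theorem vsecond_comm {s t : ZMod 2} {X Y : VField K a b} (hX : X ∈ vPar K a b s)
    (hY : Y ∈ vPar K a b t) (f : DPow K a b) :
    vsecond s t X Y f = ksign K s t • vsecond t s Y X f := by
  rw [vsecond, vsecond, Finset.sum_comm, Finset.smul_sum]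
  refine Finset.sum_congr rfl fun i _ => ?_
  rw [Finset.smul_sum]
  exact Finset.sum_congr rfl fun j _ => vsecond_term hX hY f i j

theorem vsecond_self {s : ZMod 2} {X : VField K a b} (hX : X ∈ vPar K a b s) (f : DPow K a b)
    (hs : ksign K s s = -1)
    (hd : ∀ i, dmul K a b (X i) (dmul K a b (X i) (pderiv K a b i (pderiv K a b i f))) = 0) :
    vsecond s s X X f = 0 := by
  rw [vsecond, ← Finset.sum_product' (s := Finset.univ) (t := Finset.univ)
    (f := fun j i => ksign K s (s + varPar j) •
    dmul K a b (X j) (dmul K a b (X i) (pderiv K a b i (pderiv K a b j f))))]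
  refine Finset.sum_involution (fun p _ => p.swap) ?_ ?_ ?_ ?_
  · rintro ⟨j, i⟩ _
    simp only [Prod.fst_swap, Prod.snd_swap]
    rw [vsecond_term hX hX f i j, hs, neg_one_smul, neg_add_cancel]
  · rintro ⟨j, i⟩ _ hne h
    rw [Prod.swap_prod_mk, Prod.mk.injEq] at h
    apply hne
    simp only
    rw [h.1, hd, smul_zero]
  · intro p _; simp
  · intro p _; simp

theorem vact_vbr {s t : ZMod 2} {X Y : VField K a b} (hX : X ∈ vPar K a b s)
    (hY : Y ∈ vPar K a b t) :
    vact (vbr s t X Y) = vact X * vact Y - ksign K s t • (vact Y * vact X) := by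
  refine LinearMap.ext fun f => ?_
  rw [vbr_apply, map_sub, map_smul, LinearMap.sub_apply, LinearMap.sub_apply,
    LinearMap.smul_apply, LinearMap.smul_apply, Module.End.mul_apply, Module.End.mul_apply,
    vact_vact hX hY, vact_vact hY hX, vsecond_comm hX hY, smul_add]
  abel

theorem vact_vmul_self {X : VField K a b} (hX : X ∈ vPar K a b 1) :
    vact (vmul X X) = vact X * vact X := by
  refine LinearMap.ext fun f => ?_
  rw [Module.End.mul_apply, vact_vact hX hX, vsecond_self hX f (by simp [ksign]), add_zero]
  rintro (i | i)
  · rw [← dmul_assoc, dmul_self_odd, map_zero, LinearMap.zero_apply]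
    simpa [varPar] using mem_vPar.1 hX (.inl i)
  · rw [pderiv_odd_sq, map_zero, map_zero]

/-- The indeterminates `z_i`, `ξ_j` as elements of `O(a|b)`. -/
noncomputable def coord (K : Type*) [Field K] {a b : ℕ} : Fin a ⊕ Fin b → DPow K a b
  | .inl i => Finsupp.single (Pi.single i 1, ∅) 1
  | .inr j => Finsupp.single (0, {j}) 1

theorem pderiv_coord (i j : Fin a ⊕ Fin b) :
    pderiv K a b i (coord K j) = if i = j then dpOne else 0 := by
  rcases i with i | i <;> rcases j with j | j <;>
    simp only [coord, pderiv_single, derMon, derCoeff, dpOne, Sum.inl.injEq, Sum.inr.injEq,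
      reduceCtorEq]
  · by_cases h : i = j
    · subst h; simp
    · simp [h]
  · simp
  · simp
  · by_cases h : i = j
    · subst h; simp [sgn_singleton_self]
    · simp [h]

theorem vact_coord (X : VField K a b) (j) : vact X (coord K j) = X j := by
  rw [vact_apply, Finset.sum_eq_single j]
  · rw [pderiv_coord, if_pos rfl, dmul_one]
  · intro i _ h; rw [pderiv_coord, if_neg h, map_zero]
  · simp

theorem vact_injective {X Y : VField K a b} (h : vact X = vact Y) : X = Y := by
  ext1 j
  rw [← vact_coord X, h, vact_coord]

/-- The even part of `vect(a|b)`. -/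
abbrev VEven (K : Type*) [Field K] (a b : ℕ) : Type _ := ↥(vPar K a b 0)
/-- The odd part of `vect(a|b)`. -/
abbrev VOdd (K : Type*) [Field K] (a b : ℕ) : Type _ := ↥(vPar K a b 1)

theorem ring_jacobi {R : Type*} [Ring R] (x y z : R) :
    x * (y * z - z * y) - (y * z - z * y) * x =
      (x * y - y * x) * z - z * (x * y - y * x) + (y * (x * z - z * x) - (x * z - z * x) * y) := by
  noncomm_ring

theorem ring_lie_sq {R : Type*} [Ring R] (x y : R) :
    x * (y * y) - y * y * x = (x * y - y * x) * y + y * (x * y - y * x) := by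
  noncomm_ring

theorem ring_sq_lie {R : Type*} [Ring R] (x y : R) :
    x * x * y - y * (x * x) = -((x * y + y * x) * x - x * (x * y + y * x)) := by
  noncomm_ring

theorem sub_ksign_one_smul {M : Type*} [AddCommGroup M] [Module K M] (x y : M) :
    x - ksign K 1 1 • y = x + y := by
  simp [ksign]

theorem vbr_odd (X Y : VField K a b) : vbr 1 1 X Y = vmul X Y + vmul Y X :=
  sub_ksign_one_smul (vmul X Y) (vmul Y X)

theorem vact_vbr_odd {X Y : VField K a b} (hX : X ∈ vPar K a b 1) (hY : Y ∈ vPar K a b 1) :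
    vact (vbr 1 1 X Y) = vact X * vact Y + vact Y * vact X :=
  (vact_vbr hX hY).trans (sub_ksign_one_smul (vact X * vact Y) (vact Y * vact X))

noncomputable instance : Bracket (VEven K a b) (VEven K a b) where
  bracket X Y := ⟨vbr 0 0 X.1 Y.1, vbr_mem_par X.2 Y.2 (add_zero 0)⟩

noncomputable instance : Bracket (VEven K a b) (VOdd K a b) where
  bracket X Y := ⟨vbr 0 1 X.1 Y.1, vbr_mem_par X.2 Y.2 (zero_add 1)⟩

theorem coe_bracket_even (X Y : VEven K a b) : (⁅X, Y⁆ : VEven K a b).1 = vbr 0 0 X.1 Y.1 := rfl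
theorem coe_bracket_odd (X : VEven K a b) (Y : VOdd K a b) :
    (⁅X, Y⁆ : VOdd K a b).1 = vbr 0 1 X.1 Y.1 := rfl

theorem vact_bracket_even (X Y : VEven K a b) :
    vact (⁅X, Y⁆ : VEven K a b).1 = vact X.1 * vact Y.1 - vact Y.1 * vact X.1 := by
  rw [coe_bracket_even, vact_vbr X.2 Y.2]; simp [ksign]

theorem vact_bracket_odd (X : VEven K a b) (Y : VOdd K a b) :
    vact (⁅X, Y⁆ : VOdd K a b).1 = vact X.1 * vact Y.1 - vact Y.1 * vact X.1 := by
  rw [coe_bracket_odd, vact_vbr X.2 Y.2]; simp [ksign]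

noncomputable instance : LieRing (VEven K a b) where
  add_lie X Y Z := Subtype.ext (by simp [coe_bracket_even])
  lie_add X Y Z := Subtype.ext (by simp [coe_bracket_even])
  lie_self X := Subtype.ext (by simp [coe_bracket_even, vbr_apply, ksign])
  leibniz_lie X Y Z := by
    apply Subtype.ext
    apply vact_injective
    simp only [Submodule.coe_add, map_add, vact_bracket_even]
    exact ring_jacobi (vact X.1) (vact Y.1) (vact Z.1)

noncomputable instance : LieAlgebra K (VEven K a b) where
  lie_smul c X Y := Subtype.ext (by simp [coe_bracket_even])

noncomputable instance : LieRingModule (VEven K a b) (VOdd K a b) where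
  add_lie X Y Z := Subtype.ext (by simp [coe_bracket_odd])
  lie_add X Y Z := Subtype.ext (by simp [coe_bracket_odd])
  leibniz_lie X Y Z := by
    apply Subtype.ext
    apply vact_injective
    simp only [Submodule.coe_add, map_add, vact_bracket_even, vact_bracket_odd]
    exact ring_jacobi (vact X.1) (vact Y.1) (vact Z.1)

noncomputable instance : LieModule K (VEven K a b) (VOdd K a b) where
  smul_lie c X Y := Subtype.ext (by simp [coe_bracket_odd])
  lie_smul c X Y := Subtype.ext (by simp [coe_bracket_odd])

/-- The Lie superalgebra `vect(a|b)` of all vector fields. The square of an odd field is its square as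
an operator, which is the field with coefficients `X(X_k)`. -/
noncomputable def vectSuper (K : Type*) [Field K] (a b : ℕ) :
    LieSuperalgebra K (VEven K a b) (VOdd K a b) where
  sq X := ⟨vmul X.1 X.1, vmul_mem_par X.2 X.2 one_add_one_zmod⟩
  oddBracket := LinearMap.mk₂ K (fun X Y => (⟨vbr 1 1 X.1 Y.1,
      vbr_mem_par X.2 Y.2 one_add_one_zmod⟩ : VEven K a b))
    (fun X Y Z => Subtype.ext (by simp)) (fun c X Y => Subtype.ext (by simp))
    (fun X Y Z => Subtype.ext (by simp)) (fun c X Y => Subtype.ext (by simp))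
  sq_smul c X := Subtype.ext (by simp [pow_two, smul_smul])
  sq_add X Y := Subtype.ext (by
    simp only [Submodule.coe_add, map_add, LinearMap.add_apply, LinearMap.mk₂_apply, vbr_odd]
    abel)
  lie_sq X Y := by
    apply Subtype.ext
    apply vact_injective
    rw [vact_bracket_even, LinearMap.mk₂_apply, vact_vbr_odd (Subtype.property _) Y.2,
      vact_bracket_odd, vact_vmul_self Y.2]
    exact ring_lie_sq (vact X.1) (vact Y.1)
  sq_lie X Y := by
    apply Subtype.ext
    apply vact_injective
    rw [Submodule.coe_neg, map_neg, vact_bracket_odd, vact_bracket_odd, LinearMap.mk₂_apply,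
      vact_vbr_odd X.2 Y.2, vact_vmul_self X.2]
    exact ring_sq_lie (vact X.1) (vact Y.1)
  sq_lie_self X := by
    apply Subtype.ext
    apply vact_injective
    rw [vact_bracket_odd, vact_vmul_self X.2, mul_assoc, Submodule.coe_zero, map_zero]
    exact sub_self (vact X.1 * (vact X.1 * vact X.1))

/-! ### The Lie algebras `vect(a; N|0)` -/

/-- `O(a; N|b)`: only exponents `α_i < p ^ N_i` occur. -/
def dpShear (K : Type*) [Field K] (a b p : ℕ) (N : Fin a → ℕ) : Submodule K (DPow K a b) :=
  Finsupp.supported K K {x : Mon a b | ∀ i, x.1 i < p ^ N i}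

theorem dvd_choose_of_carry {p N k n : ℕ} (hp : p.Prime) (hk : k < p ^ N) (hn : n < p ^ N)
    (h : p ^ N ≤ k + n) : p ∣ (k + n).choose k := by
  have hN : N ≠ 0 := by rintro rfl; simp at hk hn h; omega
  have h1 := hp.emultiplicity_choose' (n := n) (k := k) (b := max (N + 1) (Nat.log p (n + k) + 1))
    (by simp)
  rw [add_comm k n]
  apply dvd_of_emultiplicity_pos
  rw [h1]
  have : 0 < (Finset.filter (fun i => p ^ i ≤ k % p ^ i + n % p ^ i)
      (Finset.Ico 1 (max (N + 1) (Nat.log p (n + k) + 1)))).card := by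
    refine Finset.card_pos.2 ⟨N, ?_⟩
    simp only [Finset.mem_filter, Finset.mem_Ico, Nat.mod_eq_of_lt hk, Nat.mod_eq_of_lt hn, h,
      and_true]
    constructor
    · omega
    · simp
  exact_mod_cast this

theorem dpShear_induction {p : ℕ} {N : Fin a → ℕ}
    {P : (f : DPow K a b) → f ∈ dpShear K a b p N → Prop}
    (h0 : P 0 (Submodule.zero_mem _))
    (hadd : ∀ f g (hf : f ∈ dpShear K a b p N) (hg : g ∈ dpShear K a b p N), P f hf → P g hg →
      P (f + g) (Submodule.add_mem _ hf hg))
    (hs : ∀ (x : Mon a b) (c : K) (hx : ∀ i, x.1 i < p ^ N i),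
      P (Finsupp.single x c) (Finsupp.single_mem_supported K c hx))
    (f : DPow K a b) (hf : f ∈ dpShear K a b p N) : P f hf := by
  induction f using Finsupp.induction with
  | zero => exact h0
  | single_add x c f hx hc ih =>
    have h1 : ∀ i, x.1 i < p ^ N i := by
      apply hf
      simp [Finsupp.mem_support_iff, Finsupp.notMem_support_iff.1 hx, hc]
    have h2 : Finsupp.single x c ∈ dpShear K a b p N := Finsupp.single_mem_supported K c h1
    have h3 : f ∈ dpShear K a b p N := by
      have := Submodule.sub_mem _ hf h2
      rwa [add_sub_cancel_left] at this
    exact hadd _ _ h2 h3 (hs x c h1) (ih h3)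

theorem dmul_mem_shear {p : ℕ} [CharP K p] [hp : Fact p.Prime] {N : Fin a → ℕ} {f g : DPow K a b}
    (hf : f ∈ dpShear K a b p N) (hg : g ∈ dpShear K a b p N) :
    dmul K a b f g ∈ dpShear K a b p N := by
  induction f, hf using dpShear_induction with
  | h0 => simp
  | hadd f₁ f₂ _ _ h₁ h₂ => simpa using Submodule.add_mem _ h₁ h₂
  | hs x c hx =>
  induction g, hg using dpShear_induction with
  | h0 => simp
  | hadd f₁ f₂ _ _ h₁ h₂ => simpa using Submodule.add_mem _ h₁ h₂
  | hs y d hy =>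
  rw [dmul_single]
  by_cases h : ∀ i, x.1 i + y.1 i < p ^ N i
  · exact Finsupp.single_mem_supported _ _ h
  · push Not at h
    obtain ⟨i, hi⟩ := h
    have h1 : p ∣ binom x.1 y.1 :=
      (dvd_choose_of_carry hp.out (hx i) (hy i) hi).trans
        (Finset.dvd_prod_of_mem _ (Finset.mem_univ i))
    have h2 : (binom x.1 y.1 : K) = 0 := (CharP.cast_eq_zero_iff K p _).2 h1
    simp [mulCoeff, h2]

theorem pderiv_mem_shear {p : ℕ} {N : Fin a → ℕ} {f : DPow K a b}
    (hf : f ∈ dpShear K a b p N) (i) : pderiv K a b i f ∈ dpShear K a b p N := by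
  induction f, hf using dpShear_induction with
  | h0 => simp
  | hadd f₁ f₂ _ _ h₁ h₂ => simpa using Submodule.add_mem _ h₁ h₂
  | hs x c hx =>
  rw [pderiv_single]
  apply Finsupp.single_mem_supported
  intro k
  refine lt_of_le_of_lt ?_ (hx k)
  rcases i with i | j
  · exact Nat.sub_le _ _
  · exact le_rfl

theorem vact_mem_shear {p : ℕ} [CharP K p] [Fact p.Prime] {N : Fin a → ℕ} {X : VField K a b}
    {f : DPow K a b} (hX : ∀ i, X i ∈ dpShear K a b p N) (hf : f ∈ dpShear K a b p N) :
    vact X f ∈ dpShear K a b p N := by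
  rw [vact_apply]
  exact Submodule.sum_mem _ fun i _ => dmul_mem_shear (hX i) (pderiv_mem_shear hf i)

/-- `vect(a; N|0)`, the Lie algebra of vector fields in `a` even indeterminates with shearing vector `N`.
(There are no odd indeterminates, hence all fields are even.) -/
noncomputable def vect (K : Type*) [Field K] (a p : ℕ) [CharP K p] [Fact p.Prime] (N : Fin a → ℕ) :
    LieSubalgebra K (VEven K a 0) where
  carrier := {X | ∀ i, X.1 i ∈ dpShear K a 0 p N}
  zero_mem' _ := Submodule.zero_mem _
  add_mem' hX hY i := Submodule.add_mem _ (hX i) (hY i)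
  smul_mem' c _ hX i := Submodule.smul_mem _ c (hX i)
  lie_mem' {X Y} hX hY i := Submodule.sub_mem _ (vact_mem_shear hX (hY i))
    (Submodule.smul_mem _ _ (vact_mem_shear hY (hX i)))

/-- `vect(n; N_s|0)` with `N_s = (1, …, 1)` in characteristic 2, the restricted Witt algebra. -/
noncomputable abbrev vectS (K : Type*) [Field K] [CharP K 2] (n : ℕ) : LieSubalgebra K (VEven K n 0) :=
  vect K n 2 (fun _ => 1)

theorem coord_mem_shear [CharP K 2] (j : Fin a ⊕ Fin 0) :
    coord K j ∈ dpShear K a 0 2 (fun _ => 1) := by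
  rcases j with j | j
  · apply Finsupp.single_mem_supported
    intro i
    by_cases h : i = j
    · subst h; simp
    · simp [h]
  · exact j.elim0

theorem pderiv_sq_shear [CharP K 2] (i : Fin a ⊕ Fin 0) {f : DPow K a 0}
    (hf : f ∈ dpShear K a 0 2 (fun _ => 1)) : pderiv K a 0 i (pderiv K a 0 i f) = 0 := by
  induction f, hf using dpShear_induction with
  | h0 => simp
  | hadd f₁ f₂ _ _ h₁ h₂ => simp [h₁, h₂]
  | hs x c hx =>
  rcases i with i | i
  · have h1 := hx i
    have h2 : x.1 i - 1 = 0 := by simp at h1; omega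
    simp [pderiv_single, derCoeff, derMon, h2]
  · exact i.elim0

theorem vact_square [CharP K 2] (X : vectS K a) {f : DPow K a 0}
    (hf : f ∈ dpShear K a 0 2 (fun _ => 1)) :
    vact (vmul X.1.1 X.1.1) f = vact X.1.1 (vact X.1.1 f) := by
  rw [vact_vact X.1.2 X.1.2, vsecond_self X.1.2, add_zero]
  · simp [ksign, CharTwo.neg_eq]
  · intro i
    rw [pderiv_sq_shear i hf, map_zero, map_zero]

/-- The square of `X` as an operator on `O(n; N_s|0)`; see `vact_square`. -/
noncomputable def vectSSq [CharP K 2] (X : vectS K a) : vectS K a :=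
  ⟨⟨vmul X.1.1 X.1.1, vmul_mem_par X.1.2 X.1.2 (add_zero 0)⟩, fun i => vact_mem_shear X.2 (X.2 i)⟩

theorem vectS_ext [CharP K 2] {X Y : vectS K a}
    (h : ∀ f ∈ dpShear K a 0 2 (fun _ => 1), vact X.1.1 f = vact Y.1.1 f) : X = Y := by
  apply Subtype.ext
  apply Subtype.ext
  ext1 j
  rw [← vact_coord X.1.1, ← vact_coord Y.1.1, h _ (coord_mem_shear j)]

theorem vact_bracket_vectS [CharP K 2] (X Y : vectS K a) :
    vact (⁅X, Y⁆ : vectS K a).1.1 = vact X.1.1 * vact Y.1.1 - vact Y.1.1 * vact X.1.1 :=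
  vact_bracket_even X.1 Y.1

/-- The 2-structure of `vect(n; N_s|0)`: `X^[2]` is the square of the derivation `X` of `O(n; N_s|0)`. -/
noncomputable def vectSTwo (K : Type*) [Field K] [CharP K 2] (n : ℕ) :
    TwoStructure K (vectS K n) where
  sq := vectSSq
  sq_smul c X := Subtype.ext (Subtype.ext (by simp [vectSSq, pow_two, smul_smul]))
  sq_add X Y := by
    apply Subtype.ext
    apply Subtype.ext
    change vmul (X.1.1 + Y.1.1) (X.1.1 + Y.1.1) = vmul X.1.1 X.1.1 + vmul Y.1.1 Y.1.1 +
      vbr 0 0 X.1.1 Y.1.1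
    have := neg_eq_self_of_char_two K (vmul Y.1.1 X.1.1)
    simp only [map_add, LinearMap.add_apply, vbr_apply, ksign, sub_eq_add_neg]
    simp [this]; abel
  sq_lie X Y := by
    apply vectS_ext
    intro f hf
    have h1 : vact Y.1.1 f ∈ dpShear K n 0 2 (fun _ => 1) := vact_mem_shear Y.2 hf
    have h2 := neg_eq_self_of_char_two K (vact Y.1.1 (vact X.1.1 (vact X.1.1 f)))
    have h3 := neg_eq_self_of_char_two K (vact X.1.1 (vact Y.1.1 (vact X.1.1 f)))
    simp only [vact_bracket_vectS, LinearMap.sub_apply, Module.End.mul_apply, map_sub]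
    change vact (vmul X.1.1 X.1.1) (vact Y.1.1 f) - vact Y.1.1 (vact (vmul X.1.1 X.1.1) f) = _
    rw [vact_square X h1, vact_square X hf, sub_eq_add_neg _ (vact Y.1.1 (vact X.1.1 _)), h2,
      sub_eq_add_neg _ (vact X.1.1 (vact Y.1.1 _)), h3]
    abel

/-! ### `q(n)` and its identity representation by vector fields -/

attribute [local instance] LieRing.ofAssociativeRing

/-- Queerification of an associative algebra: `q(A) = A ⊕ Π(A)` with `[x, y] = xy - yx`,
`[x, Π y] = Π(xy - yx)`, `[Π x, Π y] = xy + yx`, `(Π x)² = x²`. For `A = Mat(n)` this is `q(n)`. -/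
def queerAssoc (K A : Type*) [CommRing K] [Ring A] [Algebra K A] : LieSuperalgebra K A A where
  sq x := x * x
  oddBracket := LinearMap.mul K A + (LinearMap.mul K A).flip
  sq_smul c x := by simp [pow_two, smul_smul]
  sq_add x y := by simp; noncomm_ring
  lie_sq x y := by simp [LieRing.of_associative_ring_bracket]; noncomm_ring
  sq_lie x y := by simp [LieRing.of_associative_ring_bracket]; noncomm_ring
  sq_lie_self x := by simp [LieRing.of_associative_ring_bracket, mul_assoc]

/-- The linear vector field `∑ M_{ik} x_i ∂_{x_k}` of a matrix `M`, where `x` runs over `z, ξ`. -/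
noncomputable def linField (K : Type*) [Field K] (a b : ℕ) :
    Matrix (Fin a ⊕ Fin b) (Fin a ⊕ Fin b) K →ₗ[K] VField K a b where
  toFun M k := ∑ i, M i k • coord K i
  map_add' M N := by ext1 k; simp [add_smul, Finset.sum_add_distrib]
  map_smul' c M := by ext1 k; simp [mul_smul, Finset.smul_sum]

theorem linField_apply (M : Matrix (Fin a ⊕ Fin b) (Fin a ⊕ Fin b) K) (k) :
    linField K a b M k = ∑ i, M i k • coord K i := rfl

theorem vmul_linField (M N : Matrix (Fin a ⊕ Fin b) (Fin a ⊕ Fin b) K) :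
    vmul (linField K a b M) (linField K a b N) = linField K a b (M * N) := by
  ext1 k
  rw [vmul_apply, linField_apply N, map_sum, linField_apply]
  simp only [map_smul, vact_coord, linField_apply, Matrix.mul_apply, Finset.sum_smul,
    Finset.smul_sum, smul_smul]
  rw [Finset.sum_comm]
  simp only [mul_comm]

theorem coord_mem_par (i : Fin a ⊕ Fin b) : coord K i ∈ dpPar K a b (varPar i) := by
  rcases i with i | i <;> apply Finsupp.single_mem_supported <;> simp [varPar]

theorem linField_mem_par {s : ZMod 2} {M : Matrix (Fin a ⊕ Fin b) (Fin a ⊕ Fin b) K}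
    (h : ∀ i k, varPar i ≠ s + varPar k → M i k = 0) : linField K a b M ∈ vPar K a b s := by
  rw [mem_vPar]
  intro k
  rw [linField_apply]
  refine Submodule.sum_mem _ fun i _ => ?_
  by_cases hik : varPar i = s + varPar k
  · rw [← hik]
    exact Submodule.smul_mem _ _ (coord_mem_par i)
  · rw [h i k hik, zero_smul]
    exact Submodule.zero_mem _

/-- `(A, 0) ∈ q(n)` acts as `∑ A_ij (z_i ∂_{z_j} + ξ_i ∂_{ξ_j})`. -/
noncomputable def queerEven (K : Type*) [Field K] (n : ℕ) :
    Matrix (Fin n) (Fin n) K →ₗ[K] VEven K n n where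
  toFun A := ⟨linField K n n (Matrix.fromBlocks A 0 0 A), linField_mem_par (by
    rintro (i | i) (k | k) h <;> simp_all [varPar])⟩
  map_add' A B := Subtype.ext (by
    rw [Submodule.coe_add, ← map_add, Matrix.fromBlocks_add, add_zero])
  map_smul' c A := Subtype.ext (by
    rw [RingHom.id_apply, Submodule.coe_smul, ← map_smul, Matrix.fromBlocks_smul, smul_zero])

/-- `(0, B) ∈ q(n)` acts as `∑ B_ij (z_i ∂_{ξ_j} + ξ_i ∂_{z_j})`. -/
noncomputable def queerOdd (K : Type*) [Field K] (n : ℕ) :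
    Matrix (Fin n) (Fin n) K →ₗ[K] VOdd K n n where
  toFun B := ⟨linField K n n (Matrix.fromBlocks 0 B B 0), linField_mem_par (by
    rintro (i | i) (k | k) h <;> simp_all [varPar, one_add_one_zmod])⟩
  map_add' A B := Subtype.ext (by
    rw [Submodule.coe_add, ← map_add, Matrix.fromBlocks_add, add_zero])
  map_smul' c A := Subtype.ext (by
    rw [RingHom.id_apply, Submodule.coe_smul, ← map_smul, Matrix.fromBlocks_smul, smul_zero])

theorem vbr_even (s : ZMod 2) (X Y : VField K a b) : vbr 0 s X Y = vmul X Y - vmul Y X := by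
  simp [vbr_apply, ksign]

theorem fromBlocks_sub {n : ℕ} (A B C D A' B' C' D' : Matrix (Fin n) (Fin n) K) :
    Matrix.fromBlocks A B C D - Matrix.fromBlocks A' B' C' D' =
      Matrix.fromBlocks (A - A') (B - B') (C - C') (D - D') := by
  ext (i | i) (j | j) <;> simp

/-- The identity representation of `q(n)`, realized by linear vector fields on `n|n` indeterminates:
`(A, B)` goes to the field of the matrix with blocks `A, B; B, A`. -/
noncomputable def idRep (K : Type*) [Field K] (n : ℕ) :
    LieSuperHom (queerAssoc K (Matrix (Fin n) (Fin n) K)) (vectSuper K n n) where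
  even :=
   { queerEven K n with
     map_lie' := fun {A B} => Subtype.ext (by
      change linField K n n (Matrix.fromBlocks (A * B - B * A) 0 0 (A * B - B * A)) =
        vbr 0 0 (linField K n n _) (linField K n n _)
      rw [vbr_even, vmul_linField, vmul_linField, ← map_sub, Matrix.fromBlocks_multiply,
        Matrix.fromBlocks_multiply, fromBlocks_sub]
      simp) }
  odd := queerOdd K n
  map_lie_odd A B := Subtype.ext (by
      change linField K n n (Matrix.fromBlocks 0 (A * B - B * A) (A * B - B * A) 0) =
        vbr 0 1 (linField K n n _) (linField K n n _)
      rw [vbr_even, vmul_linField, vmul_linField, ← map_sub, Matrix.fromBlocks_multiply,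
        Matrix.fromBlocks_multiply, fromBlocks_sub]
      simp)
  map_sq B := Subtype.ext (by
      change linField K n n (Matrix.fromBlocks (B * B) 0 0 (B * B)) =
        vmul (linField K n n _) (linField K n n _)
      rw [vmul_linField, Matrix.fromBlocks_multiply]
      simp)
  map_oddBracket A B := Subtype.ext (by
      change linField K n n (Matrix.fromBlocks (A * B + B * A) 0 0 (A * B + B * A)) =
        vbr 1 1 (linField K n n _) (linField K n n _)
      rw [vbr_odd, vmul_linField, vmul_linField, ← map_add, Matrix.fromBlocks_multiply,
        Matrix.fromBlocks_multiply, Matrix.fromBlocks_add]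
      simp)

/-- The part of parity `s` of the image of `q(n)` in `vect(n|n)`. -/
noncomputable def queerImage (K : Type*) [Field K] (n : ℕ) (s : ZMod 2) :
    Submodule K (VField K n n) :=
  if s = 0 then (LinearMap.range (idRep K n).even.toLinearMap).map (vPar K n n 0).subtype
  else (LinearMap.range (idRep K n).odd).map (vPar K n n 1).subtype

/-! ### Generalized Cartan prolongation -/

/-- The degree of a monomial; all indeterminates have degree 1. -/
def monDeg {a b : ℕ} (x : Mon a b) : ℤ := (∑ i, (x.1 i : ℤ)) + x.2.card

/-- The homogeneous elements of `O(a|b)` of degree `k`. -/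
noncomputable def dpDeg (K : Type*) [Field K] (a b : ℕ) (k : ℤ) : Submodule K (DPow K a b) :=
  Finsupp.supported K K {x : Mon a b | monDeg x = k}

/-- The vector fields of degree `k`: `deg ∂_i = -1`, so the coefficients have degree `k + 1`. -/
noncomputable def vDeg (K : Type*) [Field K] (a b : ℕ) (k : ℤ) : Submodule K (VField K a b) :=
  Submodule.pi Set.univ fun _ => dpDeg K a b (k + 1)

/-- The vector field `∂_i`. -/
noncomputable def partialField (K : Type*) [Field K] {a b : ℕ} (i : Fin a ⊕ Fin b) :
    VField K a b := Pi.single i dpOne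

/-- The components of degree `k ≥ 0` and parity `s` of the Cartan prolong `(id, g)_*` of a subspace `g` of
the vector fields of degree 0 (given by its even and odd part): in degree 0 it is `g`, and in degree
`k + 1` it consists of the fields `X` of degree `k + 1` such that all `[∂_i, X]` lie in the component
of degree `k`. -/
noncomputable def prolongComp (g : ZMod 2 → Submodule K (VField K a b)) :
    ℕ → ZMod 2 → Submodule K (VField K a b)
  | 0, s => g s
  | k + 1, s => vPar K a b s ⊓ vDeg K a b ((k + 1 : ℕ) : ℤ) ⊓
      ⨅ i, (prolongComp g k (varPar i + s)).comap (vbr (varPar i) s (partialField K i))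

/-- The part of parity `s` of the Cartan prolong `(id, g)_*`: the direct sum of its component of degree
`-1`, which is spanned by the `∂_i` of parity `s`, and those of degree `k ≥ 0`. -/
noncomputable def prolong (g : ZMod 2 → Submodule K (VField K a b)) (s : ZMod 2) :
    Submodule K (VField K a b) :=
  (vPar K a b s ⊓ vDeg K a b (-1)) ⊔ ⨆ k, prolongComp g k s

theorem one_mem_par : (dpOne : DPow K a b) ∈ dpPar K a b 0 :=
  Finsupp.single_mem_supported _ _ (by simp)

theorem partialField_mem_par {i : Fin a ⊕ Fin b} {s : ZMod 2} (hs : varPar i = s) :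
    partialField K i ∈ vPar K a b s := by
  subst hs
  rw [mem_vPar]
  intro j
  by_cases h : j = i
  · subst h
    rw [partialField, Pi.single_eq_same, CharTwo.add_self_eq_zero]
    exact one_mem_par
  · rw [partialField, Pi.single_eq_of_ne h]
    exact Submodule.zero_mem _

/-- `∂_{z_i}` as an element of `vect(n; N_s|0)`. -/
noncomputable def vectPartial (K : Type*) [Field K] [CharP K 2] {n : ℕ} (i : Fin n) :
    vectS K n :=
  ⟨⟨partialField K (.inl i), partialField_mem_par rfl⟩, fun j => by
    by_cases h : j = .inl i
    · subst h
      simp only [partialField, Pi.single_eq_same]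
      exact Finsupp.single_mem_supported _ _ (by simp)
    · simp only [partialField, Pi.single_eq_of_ne h]
      exact Submodule.zero_mem _⟩

end
end QProlong

open QProlong

namespace QProlong

section
variable {K : Type*} [Field K] {a b : ℕ}

/-! ### Coefficients of derivatives and degrees -/

/-! Write $x'$ for the partner of an indeterminate $x$ under the exchange $z_i \leftrightarrow
\xi_i$. Bracketing with $\partial_i$ differentiates all coefficients, with no sign
(`vbr_partialField`), so the prolongation conditions are linear conditions on iterated derivatives.
A field of degree 0 and given parity lies in the image of $\mathfrak q(n)$ exactly when its Jacobian
satisfies $\partial_{j'}X_{k'} = \partial_j X_k$ (`queerImage_eq`).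

If $2 \ne 0$ in $K$, let $X$ have degree 1 and put $H_{ijk} = \partial_j\partial_i X_k$. The
condition on $\partial_i X$ allows $(j,k)$ to be replaced by $(j',k')$; after transposing the two
derivatives, which costs a sign, $(i,k)$ can be replaced as well. Performing the two replacements in
either order leads from $H_{ijk}$ to $H_{i'j'k}$, but with opposite signs, so $2H = 0$
(`two_smul_eq_zero_of_swap`). All second derivatives of the quadratic coefficients vanish, hence $X
= 0$, and the higher components vanish by induction.

If $p = 2$, the derivatives commute without sign and the Jacobian condition propagates to every
degree: the prolong consists of fields with swap-invariant Jacobian (`prolongComp_queerImage_eq`).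
For such a field of fixed parity, $X_{z_j}$ and $X_{\xi_j}$ form a pair $(G_0, G_1)$ with
Cauchy–Riemann equations $\partial_{z_i}G_t = \partial_{\xi_i}G_{t+1}$. The pair is determined by $f
= G_0|_{\xi=0}$ (`IsQueer.ext`); it consists of the even and odd parts of $f(z+\xi) = \sum_S
\xi_S\,\partial_S f$. Since $\partial_{z_i}^2 G_t = \partial_{\xi_i}^2 G_t = 0$, the function $f$
involves only exponents below 2, and conversely every such $f$ occurs (`isQueer_queerLift`). This is
where the restricted Witt algebra comes from.

Products of pairs are again pairs, so uniqueness makes $f \mapsto f(z+\xi)$ multiplicative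
(`queerLift_dmul`). Consequently the lift of a field $D$ sends the lift of $f$ to the lift of $D(f)$
(`vact_queerField`), and brackets and squares are preserved together. -/

theorem pderiv_inl_apply (i : Fin a) (f : DPow K a b) (α : Fin a → ℕ) (S : Finset (Fin b)) :
    pderiv K a b (.inl i) f (α, S) = f (α + Pi.single i 1, S) := by
  induction f using Finsupp.induction_linear with
  | zero => simp
  | add f g hf hg => simp [hf, hg]
  | single x c =>
    obtain ⟨β, T⟩ := x
    rw [pderiv_single, derCoeff, derMon, Finsupp.single_apply, Finsupp.single_apply]
    by_cases h : β i = 0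
    · have h1 : ¬ β = α + Pi.single i 1 := fun e => by simp [e] at h
      simp [h, h1]
    · have h1 : β - Pi.single i 1 = α ↔ β = α + Pi.single i 1 := by
        have hle : Pi.single i 1 ≤ β := by
          intro k
          by_cases hk : k = i
          · subst hk; simpa using Nat.one_le_iff_ne_zero.2 h
          · simp [hk]
        exact tsub_eq_iff_eq_add_of_le hle
      simp [h, h1]

theorem pderiv_inr_apply (j : Fin b) (f : DPow K a b) (α : Fin a → ℕ) (S : Finset (Fin b)) :
    pderiv K a b (.inr j) f (α, S) =
      if j ∈ S then 0 else f (α, insert j S) * sgn K {j} (insert j S) := by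
  induction f using Finsupp.induction_linear with
  | zero => simp
  | add f g hf hg => simp only [map_add, Finsupp.add_apply, hf, hg]; split_ifs <;> ring
  | single x c =>
    obtain ⟨β, T⟩ := x
    rw [pderiv_single, derCoeff, derMon, Finsupp.single_apply, Finsupp.single_apply]
    by_cases hS : j ∈ S
    · have : ¬ T.erase j = S := fun e => by simp [← e] at hS
      simp [hS, this]
    · by_cases hT : j ∈ T
      · have : T.erase j = S ↔ T = insert j S := by
          constructor
          · rintro rfl; rw [Finset.insert_erase hT]
          · rintro rfl; rw [Finset.erase_insert hS]
        simp only [hS, hT, if_true, if_false, Prod.mk.injEq, this]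
        split_ifs with h
        · rw [h.2]
        · simp
      · have : ¬ T = insert j S := fun e => by simp [e] at hT
        simp [hS, hT, this]

theorem sgn_ne_zero (S T : Finset (Fin b)) : sgn K S T ≠ 0 := fun h => by
  simpa [h] using sgn_mul_self (K := K) S T

theorem mem_dpDeg {k : ℤ} {f : DPow K a b} :
    f ∈ dpDeg K a b k ↔ ∀ x, monDeg x ≠ k → f x = 0 :=
  Finsupp.mem_supported' K f

theorem mem_dpPar {s : ZMod 2} {f : DPow K a b} :
    f ∈ dpPar K a b s ↔ ∀ x : Mon a b, (x.2.card : ZMod 2) ≠ s → f x = 0 :=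
  Finsupp.mem_supported' K f

theorem mem_vDeg {k : ℤ} {X : VField K a b} :
    X ∈ vDeg K a b k ↔ ∀ i, X i ∈ dpDeg K a b (k + 1) := by
  simp [vDeg, Submodule.mem_pi]

theorem monDeg_add_single (i : Fin a) (α : Fin a → ℕ) (S : Finset (Fin b)) :
    monDeg (α + Pi.single i 1, S) = monDeg (α, S) + 1 := by
  simp [monDeg, Finset.sum_add_distrib, Pi.single_apply]
  ring

theorem monDeg_insert {j : Fin b} (α : Fin a → ℕ) {S : Finset (Fin b)} (h : j ∉ S) :
    monDeg (α, insert j S) = monDeg (α, S) + 1 := by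
  simp [monDeg, Finset.card_insert_of_notMem h]
  ring

theorem pderiv_mem_deg {k : ℤ} {f : DPow K a b} (hf : f ∈ dpDeg K a b (k + 1))
    (i : Fin a ⊕ Fin b) : pderiv K a b i f ∈ dpDeg K a b k := by
  rw [mem_dpDeg] at hf ⊢
  rintro ⟨α, S⟩ hx
  rcases i with i | j
  · rw [pderiv_inl_apply]
    exact hf _ (by rw [monDeg_add_single]; omega)
  · rw [pderiv_inr_apply]
    split_ifs with h
    · rfl
    · rw [hf _ (by rw [monDeg_insert _ h]; omega), zero_mul]

/-- Every monomial other than 1 is of a form whose coefficient can be read off from some derivative,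
by the two coefficient formulas for $\partial_{z_i}$ and $\partial_{\xi_j}$. -/
theorem monDeg_cases (x : Mon a b) : x = (0, ∅) ∨
    (∃ (i : Fin a) (α : Fin a → ℕ) (S : Finset (Fin b)), x = (α + Pi.single i 1, S)) ∨
    ∃ (j : Fin b) (α : Fin a → ℕ) (S : Finset (Fin b)), j ∉ S ∧ x = (α, insert j S) := by
  obtain ⟨α, S⟩ := x
  by_cases hα : α = 0
  · rcases S.eq_empty_or_nonempty with rfl | ⟨j, hj⟩
    · left; rw [hα]
    · right; right
      exact ⟨j, α, S.erase j, by simp, by rw [Finset.insert_erase hj]⟩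
  · right; left
    obtain ⟨i, hi⟩ := Function.ne_iff.1 hα
    refine ⟨i, α - Pi.single i 1, S, ?_⟩
    rw [tsub_add_cancel_of_le]
    intro k
    by_cases hk : k = i
    · subst hk; simpa using Nat.one_le_iff_ne_zero.2 hi
    · simp [hk]

/-- A function all of whose derivatives vanish is constant. -/
theorem eq_smul_one_of_pderiv_eq_zero {f : DPow K a b} (h : ∀ i, pderiv K a b i f = 0) :
    f = f (0, ∅) • dpOne := by
  ext x
  rw [Finsupp.smul_apply, dpOne, Finsupp.single_apply]
  rcases monDeg_cases x with rfl | ⟨i, α, S, rfl⟩ | ⟨j, α, S, hj, rfl⟩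
  · simp
  · have h1 : ¬ ((0 : Fin a → ℕ), (∅ : Finset (Fin b))) = (α + Pi.single i 1, S) := fun e => by
      simpa using congrFun (Prod.mk.inj e).1 i
    rw [if_neg h1, smul_zero, ← pderiv_inl_apply, h, Finsupp.zero_apply]
  · have h1 : ¬ ((0 : Fin a → ℕ), (∅ : Finset (Fin b))) = (α, insert j S) := by
      simp [(Finset.insert_ne_empty j S).symm]
    have h2 := DFunLike.congr_fun (h (.inr j)) (α, S)
    rw [pderiv_inr_apply, if_neg hj, Finsupp.zero_apply] at h2
    rw [if_neg h1, smul_zero]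
    exact (mul_eq_zero.1 h2).resolve_right (sgn_ne_zero _ _)

/-- The tool that lifts an identity from derivatives to functions. With divided powers the
derivatives only shift coefficients, up to a sign, so no $p$-th powers survive in the common kernel
and the lemma holds in every characteristic. -/
theorem eq_zero_of_pderiv_eq_zero {k : ℤ} (hk : k ≠ 0) {f : DPow K a b}
    (hf : f ∈ dpDeg K a b k) (h : ∀ i, pderiv K a b i f = 0) : f = 0 := by
  rw [eq_smul_one_of_pderiv_eq_zero h, mem_dpDeg.1 hf _ (by simpa [monDeg] using hk.symm),
    zero_smul]

theorem eq_zero_of_mem_deg_neg {k : ℤ} (hk : k < 0) {f : DPow K a b}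
    (hf : f ∈ dpDeg K a b k) : f = 0 := by
  ext x
  refine mem_dpDeg.1 hf x fun h => ?_
  have : 0 ≤ monDeg x := by unfold monDeg; positivity
  omega

theorem pderiv_eq_zero_of_mem_deg_zero {f : DPow K a b} (hf : f ∈ dpDeg K a b 0)
    (i : Fin a ⊕ Fin b) : pderiv K a b i f = 0 :=
  eq_zero_of_mem_deg_neg (k := -1) (by omega) (pderiv_mem_deg (by simpa using hf) i)

theorem eq_smul_one_of_mem_deg_zero {f : DPow K a b} (hf : f ∈ dpDeg K a b 0) :
    f = f (0, ∅) • dpOne :=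
  eq_smul_one_of_pderiv_eq_zero fun i => pderiv_eq_zero_of_mem_deg_zero hf i

theorem one_mem_deg : (dpOne : DPow K a b) ∈ dpDeg K a b 0 :=
  Finsupp.single_mem_supported _ _ (by simp [monDeg])

theorem coord_mem_deg (i : Fin a ⊕ Fin b) : coord K i ∈ dpDeg K a b 1 := by
  rcases i with i | j
  · exact Finsupp.single_mem_supported _ _ (by simp [monDeg, Pi.single_apply])
  · exact Finsupp.single_mem_supported _ _ (by simp [monDeg])

theorem one_dmul (f : DPow K a b) : dmul K a b dpOne f = f := by
  induction f using Finsupp.induction_linear with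
  | zero => simp
  | add f₁ f₂ h₁ h₂ => simp [h₁, h₂]
  | single x c =>
  rw [dpOne, dmul_single]
  simp [mulMon, mulCoeff, binom, sgn]

/-- The bracket with `∂_i` is the derivative of the coefficients. -/
theorem vbr_partialField (s t : ZMod 2) (i : Fin a ⊕ Fin b) (X : VField K a b) :
    vbr s t (partialField K i) X = fun k => pderiv K a b i (X k) := by
  ext1 k
  have h1 : vact (partialField K i) (X k) = pderiv K a b i (X k) := by
    rw [vact_apply, Finset.sum_eq_single i]
    · rw [partialField, Pi.single_eq_same, one_dmul]
    · intro j _ hj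
      rw [partialField, Pi.single_eq_of_ne hj, map_zero, LinearMap.zero_apply]
    · simp
  -- The coefficients of $\partial_i$ are constants, so the second term of the bracket, and with it
  -- the sign, drops out.
  have h2 : vact X (partialField K i k) = 0 := by
    rw [vact_apply]
    refine Finset.sum_eq_zero fun j _ => ?_
    have : pderiv K a b j (partialField K i k) = 0 := by
      apply pderiv_eq_zero_of_mem_deg_zero
      by_cases h : k = i
      · subst h; rw [partialField, Pi.single_eq_same]; exact one_mem_deg
      · rw [partialField, Pi.single_eq_of_ne h]; exact Submodule.zero_mem _
    rw [this, map_zero]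
  rw [vbr_apply, Pi.sub_apply, Pi.smul_apply, vmul_apply, vmul_apply, h1, h2, smul_zero, sub_zero]

theorem mem_prolongComp_succ {g : ZMod 2 → Submodule K (VField K a b)} {k : ℕ} {s : ZMod 2}
    {X : VField K a b} : X ∈ prolongComp g (k + 1) s ↔
      X ∈ vPar K a b s ∧ X ∈ vDeg K a b ((k + 1 : ℕ) : ℤ) ∧
      ∀ i, (fun l => pderiv K a b i (X l)) ∈ prolongComp g k (varPar i + s) := by
  simp only [prolongComp, Submodule.mem_inf, Submodule.mem_iInf, Submodule.mem_comap,
    vbr_partialField, and_assoc]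

/-! ### Vector fields commuting with the odd swap -/

/-- The vector fields on `n|n` indeterminates whose Jacobian matrix is invariant under the simultaneous
exchange of all `z_i` with `ξ_i` and of all `∂_{z_i}` with `∂_{ξ_i}`. -/
noncomputable def swapInv (K : Type*) [Field K] (n : ℕ) : Submodule K (VField K n n) where
  carrier := {X | ∀ j k, pderiv K n n j.swap (X k.swap) = pderiv K n n j (X k)}
  zero_mem' j k := by simp
  add_mem' hX hY j k := by simp [hX j k, hY j k]
  smul_mem' c X hX j k := by simp [hX j k]

theorem pderiv_linField (M : Matrix (Fin a ⊕ Fin b) (Fin a ⊕ Fin b) K) (j k) :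
    pderiv K a b j (linField K a b M k) = M j k • dpOne := by
  simp only [linField_apply, map_sum, map_smul, pderiv_coord, smul_ite, smul_zero,
    Finset.sum_ite_eq, Finset.mem_univ, if_true]

theorem linField_mem_deg (M : Matrix (Fin a ⊕ Fin b) (Fin a ⊕ Fin b) K) :
    linField K a b M ∈ vDeg K a b 0 := by
  rw [mem_vDeg]
  intro k
  rw [linField_apply]
  exact Submodule.sum_mem _ fun i _ => Submodule.smul_mem _ _ (coord_mem_deg i)

/-- A coefficient of degree 1 is determined by its first derivatives, which are constants and supply
the matrix. -/
theorem eq_linField {X : VField K a b} (hX : X ∈ vDeg K a b 0) :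
    X = linField K a b (Matrix.of fun j k => pderiv K a b j (X k) (0, ∅)) := by
  ext1 k
  rw [← sub_eq_zero]
  refine eq_zero_of_pderiv_eq_zero (k := 1) one_ne_zero (Submodule.sub_mem _ ?_ ?_) fun j => ?_
  · simpa using mem_vDeg.1 hX k
  · simpa using mem_vDeg.1 (linField_mem_deg _) k
  · rw [map_sub, pderiv_linField, Matrix.of_apply, sub_eq_zero]
    exact eq_smul_one_of_mem_deg_zero (pderiv_mem_deg (mem_vDeg.1 hX k) j)

theorem mem_queerImage_zero {n : ℕ} {X : VField K n n} : X ∈ queerImage K n 0 ↔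
    ∃ A : Matrix (Fin n) (Fin n) K, linField K n n (Matrix.fromBlocks A 0 0 A) = X := by
  rw [queerImage, if_pos rfl]
  constructor
  · rintro ⟨_, ⟨A, rfl⟩, rfl⟩; exact ⟨A, rfl⟩
  · rintro ⟨A, rfl⟩; exact ⟨_, ⟨A, rfl⟩, rfl⟩

theorem mem_queerImage_one {n : ℕ} {X : VField K n n} : X ∈ queerImage K n 1 ↔
    ∃ A : Matrix (Fin n) (Fin n) K, linField K n n (Matrix.fromBlocks 0 A A 0) = X := by
  rw [queerImage, if_neg one_ne_zero]
  constructor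
  · rintro ⟨_, ⟨A, rfl⟩, rfl⟩; exact ⟨A, rfl⟩
  · rintro ⟨A, rfl⟩; exact ⟨_, ⟨A, rfl⟩, rfl⟩

/-- Parity kills either the off-diagonal or the diagonal blocks of the constant Jacobian; swap
invariance makes the two remaining blocks equal. In this form membership is a condition on
derivatives and can be compared across degrees. -/
theorem queerImage_eq (n : ℕ) (s : ZMod 2) :
    queerImage K n s = vPar K n n s ⊓ vDeg K n n 0 ⊓ swapInv K n := by
  ext X
  rw [Submodule.mem_inf, Submodule.mem_inf]
  constructor
  · intro h
    rcases zmod_two_cases s with rfl | rfl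
    · obtain ⟨A, rfl⟩ := mem_queerImage_zero.1 h
      refine ⟨⟨(queerEven K n A).2, linField_mem_deg _⟩, ?_⟩
      rintro (j | j) (k | k) <;> simp [pderiv_linField]
    · obtain ⟨A, rfl⟩ := mem_queerImage_one.1 h
      refine ⟨⟨(queerOdd K n A).2, linField_mem_deg _⟩, ?_⟩
      rintro (j | j) (k | k) <;> simp [pderiv_linField]
  · rintro ⟨⟨hp, hd⟩, hs⟩
    -- The constant term of an odd function is 0.
    have h0 : ∀ j k, s + varPar k + varPar j = 1 → pderiv K n n j (X k) (0, ∅) = 0 := by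
      intro j k e
      have := pderiv_mem_par (mem_vPar.1 hp k) j
      exact mem_dpPar.1 this _ (by rw [e]; simp)
    rcases zmod_two_cases s with rfl | rfl
    · rw [mem_queerImage_zero]
      refine ⟨Matrix.of fun j k => pderiv K n n (.inl j) (X (.inl k)) (0, ∅), ?_⟩
      rw [eq_linField hd]
      congr 1
      ext (j | j) (k | k)
      · simp [← eq_linField hd]
      · simpa using (h0 (.inl j) (.inr k) (by simp [varPar])).symm
      · simpa using (h0 (.inr j) (.inl k) (by simp [varPar])).symm
      · simpa [← eq_linField hd] using DFunLike.congr_fun (hs (.inr j) (.inr k)) (0, ∅)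
    · rw [mem_queerImage_one]
      refine ⟨Matrix.of fun j k => pderiv K n n (.inl j) (X (.inr k)) (0, ∅), ?_⟩
      rw [eq_linField hd]
      congr 1
      ext (j | j) (k | k)
      · simpa using (h0 (.inl j) (.inl k) (by simp [varPar])).symm
      · simp [← eq_linField hd]
      · simpa [← eq_linField hd] using DFunLike.congr_fun (hs (.inr j) (.inl k)) (0, ∅)
      · simpa using (h0 (.inr j) (.inr k) (by simp [varPar, one_add_one_zmod])).symm

/-! ### Characteristic different from 2 -/

theorem varPar_swap {n : ℕ} (i : Fin n ⊕ Fin n) : varPar i.swap = varPar i + 1 := by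
  rcases i with i | i <;> rfl

/-- The total sign produced by moving one derivative past another, exchanging it with its partner of
opposite parity, and moving it back. -/
theorem ksign_mul_ksign_add_one (s t : ZMod 2) :
    ksign K s t * ksign K (s + 1) t = if t = 1 then -1 else 1 := by
  rcases zmod_two_cases s with rfl | rfl <;> rcases zmod_two_cases t with rfl | rfl <;>
    simp [ksign, one_add_one_zmod]

/-- Exchanging first $i$ and then $j$ with their partners gives the sign $(-1)^{|j|}$; exchanging
$j$ first gives $(-1)^{|j'|} = -(-1)^{|j|}$. Both routes end at the same second derivative of $X_k$,
because $k$ is exchanged twice. -/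
theorem two_smul_eq_zero_of_swap {n : ℕ} {X : VField K n n}
    (h : ∀ i, (fun l => pderiv K n n i (X l)) ∈ swapInv K n) (i j k) :
    (2 : K) • pderiv K n n j (pderiv K n n i (X k)) = 0 := by
  have hs : ∀ i j k, pderiv K n n j (pderiv K n n i (X k)) =
      pderiv K n n j.swap (pderiv K n n i (X k.swap)) := fun i j k => (h i j k).symm
  -- The route that exchanges $i$ first: $\partial_i$ must be brought to the outside and back again.
  have key : ∀ i j k, pderiv K n n j (pderiv K n n i (X k)) =
      (if varPar j = 1 then -1 else 1 : K) •
        pderiv K n n j.swap (pderiv K n n i.swap (X k)) := by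
    intro i j k
    rw [pderiv_comm j i, hs j i k, pderiv_comm i.swap j, hs i.swap j k.swap, smul_smul,
      Sum.swap_swap, ← ksign_mul_ksign_add_one (varPar i) (varPar j), varPar_swap]
    congr 1
    simp only [ksign]
    simp only [and_comm]
  -- The route that exchanges $j$ first: after it `key` is applied at $(i, j', k')$, and the
  -- exchange in the last two places is then used to return to $\partial_{j'}\partial_{i'}X_k$.
  have key2 : pderiv K n n j (pderiv K n n i (X k)) =
      (if varPar j.swap = 1 then -1 else 1 : K) •
        pderiv K n n j.swap (pderiv K n n i.swap (X k)) := by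
    rw [hs i j k, key i j.swap k.swap, Sum.swap_swap, hs i.swap j k.swap, Sum.swap_swap]
  have key1 := key i j k
  rw [varPar_swap] at key2
  rw [two_smul]
  nth_rewrite 1 [key1]
  rw [key2, ← add_smul]
  rcases zmod_two_cases (varPar j) with e | e <;> simp [e, one_add_one_zmod]

theorem prolongComp_queerImage_eq_bot (h2 : (2 : K) ≠ 0) (n k : ℕ) (s : ZMod 2) :
    prolongComp (queerImage K n) (k + 1) s = ⊥ := by
  induction k generalizing s with
  | zero =>
    rw [eq_bot_iff]
    intro X hX
    rw [mem_prolongComp_succ] at hX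
    obtain ⟨_, hd, hX⟩ := hX
    simp only [prolongComp, queerImage_eq, Submodule.mem_inf] at hX
    rw [Submodule.mem_bot]
    ext1 l
    -- A field of degree 1 has coefficients of degree 2, so two rounds of differentiation are needed
    -- to reach the second derivatives.
    refine eq_zero_of_pderiv_eq_zero (k := 1 + 1) (by norm_num)
      (by simpa using mem_vDeg.1 hd l) fun i => ?_
    refine eq_zero_of_pderiv_eq_zero (k := 1) (by norm_num)
      (pderiv_mem_deg (by simpa using mem_vDeg.1 hd l) _) fun j => ?_
    exact (smul_eq_zero.1 (two_smul_eq_zero_of_swap (fun i => (hX i).2) i j l)).resolve_left h2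
  | succ k ih =>
    rw [eq_bot_iff]
    intro X hX
    rw [mem_prolongComp_succ] at hX
    obtain ⟨_, hd, hX⟩ := hX
    rw [Submodule.mem_bot]
    ext1 l
    refine eq_zero_of_pderiv_eq_zero (by positivity) (mem_vDeg.1 hd l) fun i => ?_
    have := hX i
    rw [ih, Submodule.mem_bot] at this
    exact congrFun this l

/-! ### Characteristic 2: the prolong as a space of swap-invariant fields -/

theorem ksign_eq_one [CharP K 2] (s t : ZMod 2) : ksign K s t = 1 := by
  simp [ksign, CharTwo.neg_eq]

theorem pderiv_comm' [CharP K 2] (i j : Fin a ⊕ Fin b) (f : DPow K a b) :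
    pderiv K a b i (pderiv K a b j f) = pderiv K a b j (pderiv K a b i f) := by
  rw [pderiv_comm, ksign_eq_one, one_smul]

/-- Since derivatives commute without sign, differentiation preserves swap invariance. Conversely,
if all derivatives of $X$ are swap invariant, then $\partial_{j'}X_{k'} - \partial_j X_k$ has zero
derivatives and positive degree, so it vanishes. -/
theorem prolongComp_queerImage_eq [CharP K 2] (n k : ℕ) (s : ZMod 2) :
    prolongComp (queerImage K n) k s = vPar K n n s ⊓ vDeg K n n k ⊓ swapInv K n := by
  induction k generalizing s with
  | zero => rw [prolongComp, queerImage_eq, Nat.cast_zero]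
  | succ k ih =>
    ext X
    rw [mem_prolongComp_succ, Submodule.mem_inf, Submodule.mem_inf, and_assoc]
    refine and_congr_right fun hp => and_congr_right fun hd => ?_
    simp only [ih, Submodule.mem_inf]
    constructor
    · intro h j l
      rw [← sub_eq_zero]
      have hd' : ∀ l j, pderiv K n n j (X l) ∈ dpDeg K n n (k + 1 : ℕ) := fun l j =>
        pderiv_mem_deg (mem_vDeg.1 hd l) j
      refine eq_zero_of_pderiv_eq_zero (by positivity) (Submodule.sub_mem _ (hd' _ _) (hd' _ _))
        fun i => ?_
      rw [map_sub, pderiv_comm' i, pderiv_comm' i, sub_eq_zero]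
      exact (h i).2 j l
    · intro h i
      refine ⟨⟨?_, ?_⟩, fun j l => ?_⟩
      · rw [mem_vPar]
        intro l
        have := pderiv_mem_par (mem_vPar.1 hp l) i
        rwa [add_comm, ← add_assoc] at this
      · rw [mem_vDeg]
        intro l
        exact pderiv_mem_deg (by simpa using mem_vDeg.1 hd l) i
      · rw [pderiv_comm' _ i, h j l, pderiv_comm' _ i]

theorem prolong_queerImage_le [CharP K 2] (n : ℕ) (s : ZMod 2) :
    prolong (queerImage K n) s ≤ vPar K n n s ⊓ swapInv K n := by
  refine sup_le ?_ (iSup_le fun k => ?_)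
  · refine le_inf inf_le_left fun X hX j k => ?_
    -- Fields of degree $-1$ have constant coefficients, hence zero Jacobian.
    rw [pderiv_eq_zero_of_mem_deg_zero (by simpa using mem_vDeg.1 hX.2 _),
      pderiv_eq_zero_of_mem_deg_zero (by simpa using mem_vDeg.1 hX.2 _)]
  · rw [prolongComp_queerImage_eq]
    exact le_inf (inf_le_left.trans inf_le_left) inf_le_right

theorem mem_prolong_queerImage_of_mem_deg [CharP K 2] {n : ℕ} {s : ZMod 2} {X : VField K n n}
    (hp : X ∈ vPar K n n s) (hs : X ∈ swapInv K n) {k : ℤ} (hk : -1 ≤ k)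
    (hd : X ∈ vDeg K n n k) : X ∈ prolong (queerImage K n) s := by
  obtain rfl | h : k = -1 ∨ 0 ≤ k := by omega
  · exact Submodule.mem_sup_left ⟨hp, hd⟩
  · lift k to ℕ using h
    refine Submodule.mem_sup_right (Submodule.mem_iSup_of_mem k ?_)
    rw [prolongComp_queerImage_eq]
    exact ⟨⟨hp, hd⟩, hs⟩

end

section
variable {K : Type*} [Field K] {n : ℕ}

/-! ### Characteristic 2: functions of `z + ξ` -/

/-- The restriction of functions to `ξ = 0`. -/
noncomputable def bodyRes (K : Type*) [Field K] (n : ℕ) : DPow K n n →ₗ[K] DPow K n 0 :=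
  Finsupp.lsum K fun x => LinearMap.toSpanSingleton K _
    (if x.2 = ∅ then Finsupp.single (x.1, ∅) 1 else 0)

theorem bodyRes_single (x : Mon n n) (c : K) :
    bodyRes K n (Finsupp.single x c) = if x.2 = ∅ then Finsupp.single (x.1, ∅) c else 0 := by
  rw [bodyRes, Finsupp.lsum_single, LinearMap.toSpanSingleton_apply]
  split_ifs <;> simp

theorem bodyRes_apply (f : DPow K n n) (α : Fin n → ℕ) (T : Finset (Fin 0)) :
    bodyRes K n f (α, T) = f (α, ∅) := by
  have hT : ∅ = T := Subsingleton.elim _ _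
  induction f using Finsupp.induction_linear with
  | zero => simp
  | add f g hf hg => simp [hf, hg]
  | single x c =>
    obtain ⟨β, S⟩ := x
    rw [bodyRes_single]
    by_cases hS : S = ∅ <;> simp [Finsupp.single_apply, hS, hT]

theorem bodyRes_dmul (f g : DPow K n n) :
    bodyRes K n (dmul K n n f g) = dmul K n 0 (bodyRes K n f) (bodyRes K n g) := by
  induction f using Finsupp.induction_linear with
  | zero => simp
  | add f₁ f₂ h₁ h₂ => simp [h₁, h₂]
  | single x c =>
  induction g using Finsupp.induction_linear with
  | zero => simp
  | add f₁ f₂ h₁ h₂ => simp [h₁, h₂]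
  | single y d =>
  rw [dmul_single, bodyRes_single, bodyRes_single, bodyRes_single]
  by_cases hx : x.2 = ∅ <;> by_cases hy : y.2 = ∅ <;>
    simp [hx, hy, mulMon, dmul_single, mulCoeff, sgn]

/-- Every monomial of an odd function contains some $\xi_i$. -/
theorem bodyRes_odd {f : DPow K n n} (hf : f ∈ dpPar K n n 1) : bodyRes K n f = 0 := by
  ext ⟨α, T⟩
  rw [bodyRes_apply]
  exact mem_dpPar.1 hf _ (by simp)

/-- A pair of an even and an odd function, which are the two components of a function of the
indeterminates `z_i + J ξ_i` with an odd `J` such that `J² = 1`. -/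
structure IsQueer (G : ZMod 2 → DPow K n n) : Prop where
  par : ∀ t, G t ∈ dpPar K n n t
  deriv : ∀ t i, pderiv K n n (.inl i) (G t) = pderiv K n n (.inr i) (G (t + 1))

theorem add_one_add_one_zmod (t : ZMod 2) : t + 1 + 1 = t := by
  rw [add_assoc, one_add_one_zmod, add_zero]

theorem eq_add_one_of_ne_zmod {s t : ZMod 2} (h : t ≠ s) : t = s + 1 := by
  revert h; revert s t; decide

theorem IsQueer.deriv' {G : ZMod 2 → DPow K n n} (hG : IsQueer G) (t : ZMod 2) (i : Fin n) :
    pderiv K n n (.inr i) (G t) = pderiv K n n (.inl i) (G (t + 1)) := by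
  rw [hG.deriv, add_one_add_one_zmod]

/-- The Cauchy–Riemann equations express the coefficient of $z^{(\alpha)}\xi_{S\cup\{i\}}$ in $G_t$,
up to sign, by that of $z^{(\alpha+e_i)}\xi_S$ in $G_{t+1}$. Removing the odd indeterminates one at
a time leads to $S = \emptyset$, where $G_1$ has no coefficient by parity. Both $\alpha$ and $t$
change along the way, so the induction is over all of them. -/
theorem IsQueer.eq_zero {G : ZMod 2 → DPow K n n} (hG : IsQueer G)
    (h : bodyRes K n (G 0) = 0) (t : ZMod 2) : G t = 0 := by
  ext ⟨α, S⟩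
  rw [Finsupp.zero_apply]
  induction S using Finset.induction_on generalizing α t with
  | empty =>
    rcases zmod_two_cases t with rfl | rfl
    · rw [← bodyRes_apply _ _ ∅, h, Finsupp.zero_apply]
    · exact mem_dpPar.1 (hG.par 1) _ (by simp)
  | insert i S hi ih =>
    have h1 := DFunLike.congr_fun (hG.deriv' t i) (α, S)
    rw [pderiv_inr_apply, if_neg hi, pderiv_inl_apply, ih] at h1
    exact (mul_eq_zero.1 h1).resolve_right (sgn_ne_zero _ _)

theorem IsQueer.ext {G H : ZMod 2 → DPow K n n} (hG : IsQueer G) (hH : IsQueer H)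
    (h : bodyRes K n (G 0) = bodyRes K n (H 0)) (t : ZMod 2) : G t = H t := by
  have hs : IsQueer (G - H) :=
    ⟨fun t => Submodule.sub_mem _ (hG.par t) (hH.par t),
      fun t i => by simp only [Pi.sub_apply, map_sub, hG.deriv, hH.deriv]⟩
  exact sub_eq_zero.1 (hs.eq_zero (by simp [h]) t)

theorem mem_dpShear_one {b : ℕ} {f : DPow K n b} : f ∈ dpShear K n b 2 (fun _ => 1) ↔
    ∀ (α : Fin n → ℕ) S, (∃ i, 2 ≤ α i) → f (α, S) = 0 := by
  rw [dpShear, Finsupp.mem_supported']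
  simp [Nat.succ_le_iff]

/-- Two applications of the Cauchy–Riemann equations turn $\partial_{z_i}^2 G_0$ into
$\partial_{\xi_i}^2 G_0 = 0$. Characteristic 2 is needed to exchange $\partial_{z_i}$ and
$\partial_{\xi_i}$ by the unsigned rule; the bound on exponents follows because a coefficient with
$\alpha_i \ge 2$ is a coefficient of this second derivative. -/
theorem IsQueer.bodyRes_mem_shear [CharP K 2] {G : ZMod 2 → DPow K n n} (hG : IsQueer G) :
    bodyRes K n (G 0) ∈ dpShear K n 0 2 (fun _ => 1) := by
  rw [mem_dpShear_one]
  rintro α T ⟨i, hi⟩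
  have hα : α = α - Pi.single i 2 + Pi.single i 1 + Pi.single i 1 := by
    ext k
    by_cases hk : k = i
    · subst hk; simp; omega
    · simp [hk]
  rw [bodyRes_apply, hα, ← pderiv_inl_apply, ← pderiv_inl_apply, hG.deriv, pderiv_comm',
    hG.deriv, pderiv_odd_sq, Finsupp.zero_apply]

theorem pderiv_dmul_char_two [CharP K 2] (i : Fin n ⊕ Fin n) {s : ZMod 2} {f : DPow K n n}
    (hf : f ∈ dpPar K n n s) (g : DPow K n n) : pderiv K n n i (dmul K n n f g) =
      dmul K n n (pderiv K n n i f) g + dmul K n n f (pderiv K n n i g) := by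
  rw [pderiv_dmul i hf, ksign_eq_one, one_smul]

/-- This is the product of $G_0 + JG_1$ and $H_0 + JH_1$ with $J^2 = 1$. In characteristic 2 even
the odd derivatives obey the unsigned Leibniz rule, so the Cauchy–Riemann equations pass to
products. -/
theorem IsQueer.mul [CharP K 2] {G H : ZMod 2 → DPow K n n} (hG : IsQueer G) (hH : IsQueer H) :
    IsQueer fun t => dmul K n n (G 0) (H t) + dmul K n n (G 1) (H (t + 1)) where
  par t := by
    refine Submodule.add_mem _ ?_ ?_
    · simpa using dmul_mem_par (hG.par 0) (hH.par t)
    · have := dmul_mem_par (hG.par 1) (hH.par (t + 1))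
      rwa [add_comm, add_one_add_one_zmod] at this
  deriv t i := by
    simp only [map_add, pderiv_dmul_char_two _ (hG.par _), hG.deriv', hH.deriv',
      add_one_add_one_zmod, zero_add, one_add_one_zmod]
    abel

/-- The indicator function of a set of indices, as an exponent. -/
def indExp (S : Finset (Fin n)) : Fin n → ℕ := fun i => if i ∈ S then 1 else 0

theorem indExp_insert {i : Fin n} {S : Finset (Fin n)} (h : i ∉ S) :
    indExp (insert i S) = indExp S + Pi.single i 1 := by
  ext k
  by_cases hk : k = i
  · subst hk; simp [indExp, h]
  · simp [indExp, hk]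

/-- The component of parity `t` of `f(z + ξ)`. -/
noncomputable def queerLift (K : Type*) [Field K] (n : ℕ) (t : ZMod 2) :
    DPow K n 0 →ₗ[K] DPow K n n :=
  Finsupp.lsum K fun x => LinearMap.toSpanSingleton K _
    (∑ S : Finset (Fin n), if (S.card : ZMod 2) = t ∧ ∀ i ∈ S, x.1 i ≠ 0 then
      Finsupp.single (x.1 - indExp S, S) 1 else 0)

/-- The Taylor expansion $\sum_S \xi_S\,\partial_S f$ in coefficients: $\partial_S$ shifts the
exponent by the indicator of $S$. -/
theorem queerLift_apply (t : ZMod 2) (f : DPow K n 0) (α : Fin n → ℕ) (S : Finset (Fin n)) :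
    queerLift K n t f (α, S) = if (S.card : ZMod 2) = t then f (α + indExp S, ∅) else 0 := by
  induction f using Finsupp.induction_linear with
  | zero => simp
  | add f g hf hg => simp only [map_add, Finsupp.add_apply, hf, hg]; split_ifs <;> simp
  | single x c =>
    obtain ⟨β, T⟩ := x
    obtain rfl : T = ∅ := Subsingleton.elim _ _
    rw [queerLift, Finsupp.lsum_single, LinearMap.toSpanSingleton_apply, Finsupp.smul_apply,
      Finsupp.finsetSum_apply, Finset.sum_eq_single S]
    · have h1 : (∀ i ∈ S, β i ≠ 0) ∧ β - indExp S = α ↔ β = α + indExp S := by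
        constructor
        · rintro ⟨h, rfl⟩
          rw [tsub_add_cancel_of_le]
          intro i
          by_cases hi : i ∈ S
          · simpa [indExp, hi] using Nat.one_le_iff_ne_zero.2 (h i hi)
          · simp [indExp, hi]
        · rintro rfl
          exact ⟨fun i hi => by simp [indExp, hi], add_tsub_cancel_right _ _⟩
      rw [Finsupp.single_apply]
      simp only [Prod.mk.injEq, and_true, ← h1]
      by_cases h2 : (S.card : ZMod 2) = t
      · by_cases h3 : ∀ i ∈ S, β i ≠ 0
        · rw [if_pos ⟨h2, h3⟩, if_pos h2, Finsupp.single_apply]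
          simp only [Prod.mk.injEq, and_true, eq_true h3, true_and, smul_eq_mul, mul_ite,
            mul_one, mul_zero]
        · rw [if_neg (fun h => h3 h.2), if_pos h2, if_neg (fun h => h3 h.1), Finsupp.zero_apply,
            smul_zero]
      · simp [h2]
    · intro U _ hU
      split_ifs
      · rw [Finsupp.single_apply, if_neg (fun e => hU (Prod.mk.inj e).2)]
      · rfl
    · simp

theorem pderiv_queerLift (t : ZMod 2) (i : Fin n) (f : DPow K n 0) :
    pderiv K n n (.inl i) (queerLift K n t f) = queerLift K n t (pderiv K n 0 (.inl i) f) := by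
  ext ⟨α, S⟩
  simp only [pderiv_inl_apply, queerLift_apply, add_right_comm]

theorem bodyRes_queerLift (f : DPow K n 0) : bodyRes K n (queerLift K n 0 f) = f := by
  ext ⟨α, T⟩
  obtain rfl : T = ∅ := Subsingleton.elim _ _
  have : indExp (∅ : Finset (Fin n)) = 0 := by ext i; simp [indExp]
  simp [bodyRes_apply, queerLift_apply, this]

theorem queerLift_mem_par (t : ZMod 2) (f : DPow K n 0) :
    queerLift K n t f ∈ dpPar K n n t := by
  rw [mem_dpPar]
  rintro ⟨α, S⟩ h
  rw [queerLift_apply, if_neg h]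

theorem queerLift_mem_deg (t : ZMod 2) {k : ℤ} {f : DPow K n 0} (hf : f ∈ dpDeg K n 0 k) :
    queerLift K n t f ∈ dpDeg K n n k := by
  rw [mem_dpDeg] at hf ⊢
  rintro ⟨α, S⟩ h
  rw [queerLift_apply]
  split_ifs
  · refine hf _ ?_
    have : monDeg (α + indExp S, (∅ : Finset (Fin 0))) = monDeg (α, S) := by
      simp [monDeg, indExp, Finset.sum_add_distrib]
    rwa [this]
  · rfl

theorem sgn_eq_one [CharP K 2] (S T : Finset (Fin n)) : sgn K S T = 1 := by
  simp [sgn, CharTwo.neg_eq]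

/-- The coefficients of $\partial_{z_i}$ and $\partial_{\xi_i}$ of the two parts agree where $i
\notin S$, all signs being 1. Where $i \in S$ the $\xi_i$-derivative has no term, and the other side
is a coefficient of $f$ with an exponent at least 2, which is excluded. -/
theorem isQueer_queerLift [CharP K 2] {f : DPow K n 0}
    (hf : f ∈ dpShear K n 0 2 (fun _ => 1)) : IsQueer fun t => queerLift K n t f where
  par t := queerLift_mem_par t f
  deriv t i := by
    ext ⟨α, S⟩
    rw [pderiv_inl_apply, pderiv_inr_apply, queerLift_apply, queerLift_apply]
    by_cases hi : i ∈ S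
    · rw [if_pos hi, mem_dpShear_one.1 hf _ _ ⟨i, by simp [indExp, hi]⟩, ite_self]
    · rw [if_neg hi, sgn_eq_one, mul_one, indExp_insert hi, Finset.card_insert_of_notMem hi,
        Nat.cast_add, Nat.cast_one, add_right_comm, add_assoc]
      simp

/-- For $s = 0$ both sides, as functions of $t$, are Cauchy–Riemann pairs with the same restriction
to $\xi = 0$, namely $fg$, since the odd parts restrict to 0. Uniqueness replaces a direct expansion
of the products. -/
theorem queerLift_dmul [CharP K 2] (s t : ZMod 2) {f g : DPow K n 0}
    (hf : f ∈ dpShear K n 0 2 (fun _ => 1)) (hg : g ∈ dpShear K n 0 2 (fun _ => 1)) :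
    queerLift K n (s + t) (dmul K n 0 f g) =
      dmul K n n (queerLift K n s f) (queerLift K n t g) +
      dmul K n n (queerLift K n (s + 1) f) (queerLift K n (t + 1) g) := by
  have h := (isQueer_queerLift (dmul_mem_shear hf hg)).ext
    ((isQueer_queerLift hf).mul (isQueer_queerLift hg)) (by
      simp [bodyRes_queerLift, bodyRes_dmul, bodyRes_odd (queerLift_mem_par 1 f)])
  rcases zmod_two_cases s with rfl | rfl
  · simpa using h t
  -- The case $s = 1$ is the case $s = 0$ at $t + 1$, with the two summands exchanged.
  · rw [add_comm 1 t, h (t + 1), add_one_add_one_zmod, one_add_one_zmod, add_comm]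

/-! ### The isomorphism in characteristic 2 -/

/-- The index `j` of the indeterminate `z_j` or `ξ_j`. -/
def varIdx : Fin n ⊕ Fin n → Fin n := Sum.elim id id

/-- The vector field of parity `s` on `n|n` indeterminates defined by a field in `n` even ones. -/
noncomputable def queerField (K : Type*) [Field K] (n : ℕ) (s : ZMod 2) :
    VField K n 0 →ₗ[K] VField K n n where
  toFun D k := queerLift K n (s + varPar k) (D (.inl (varIdx k)))
  map_add' D E := by ext1 k; simp
  map_smul' c D := by ext1 k; simp

theorem queerField_apply (s : ZMod 2) (D : VField K n 0) (k : Fin n ⊕ Fin n) :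
    queerField K n s D k = queerLift K n (s + varPar k) (D (.inl (varIdx k))) := rfl

theorem queerField_mem_par (s : ZMod 2) (D : VField K n 0) :
    queerField K n s D ∈ vPar K n n s :=
  mem_vPar.2 fun _ => queerLift_mem_par _ _

theorem queerField_mem_deg (s : ZMod 2) {k : ℤ} {D : VField K n 0} (hD : D ∈ vDeg K n 0 k) :
    queerField K n s D ∈ vDeg K n n k :=
  mem_vDeg.2 fun _ => queerLift_mem_deg _ (mem_vDeg.1 hD _)

theorem queerField_mem_swapInv [CharP K 2] (s : ZMod 2) {D : VField K n 0}
    (hD : ∀ i, D i ∈ dpShear K n 0 2 (fun _ => 1)) : queerField K n s D ∈ swapInv K n := by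
  intro j k
  have hk : varIdx k.swap = varIdx k := by rcases k with k | k <;> rfl
  have hq := isQueer_queerLift (hD (.inl (varIdx k)))
  rw [queerField_apply, queerField_apply, hk, varPar_swap, ← add_assoc]
  rcases j with j | j
  · exact (hq.deriv (s + varPar k) j).symm
  · exact (hq.deriv' (s + varPar k) j).symm

/-- For each $j$ the terms with $\partial_{z_j}$ and $\partial_{\xi_j}$ combine: the Cauchy–Riemann
equations turn both derivatives into lifts of $\partial_j f$, and the sum is the product formula for
the lift of $D_j\,\partial_j f$. -/
theorem vact_queerField [CharP K 2] (s t : ZMod 2) {D : VField K n 0} {f : DPow K n 0}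
    (hD : ∀ i, D i ∈ dpShear K n 0 2 (fun _ => 1))
    (hf : f ∈ dpShear K n 0 2 (fun _ => 1)) :
    vact (queerField K n s D) (queerLift K n t f) = queerLift K n (s + t) (vact D f) := by
  rw [vact_apply, vact_apply, map_sum, Fintype.sum_sum_type, Fintype.sum_sum_type,
    Finset.univ_eq_empty (α := Fin 0), Finset.sum_empty, add_zero, ← Finset.sum_add_distrib]
  refine Finset.sum_congr rfl fun j _ => ?_
  rw [queerLift_dmul s t (hD _) (pderiv_mem_shear hf _), (isQueer_queerLift hf).deriv' t j,
    pderiv_queerLift, pderiv_queerLift]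
  simp [queerField_apply, varPar, varIdx]

/-- Brackets and squares of fields are all built from the operation $X \triangleright Y$, so this
one identity yields every compatibility required of the embedding. -/
theorem vmul_queerField [CharP K 2] (s t : ZMod 2) {D E : VField K n 0}
    (hD : ∀ i, D i ∈ dpShear K n 0 2 (fun _ => 1))
    (hE : ∀ i, E i ∈ dpShear K n 0 2 (fun _ => 1)) :
    vmul (queerField K n s D) (queerField K n t E) = queerField K n (s + t) (vmul D E) := by
  ext1 k
  rw [vmul_apply, queerField_apply, queerField_apply, vact_queerField _ _ hD (hE _), vmul_apply,
    add_assoc]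

theorem vbr_queerField [CharP K 2] (s t : ZMod 2) {D E : VField K n 0}
    (hD : ∀ i, D i ∈ dpShear K n 0 2 (fun _ => 1))
    (hE : ∀ i, E i ∈ dpShear K n 0 2 (fun _ => 1)) :
    vbr s t (queerField K n s D) (queerField K n t E) = queerField K n (s + t) (vbr 0 0 D E) := by
  rw [vbr_apply, vbr_apply, vmul_queerField _ _ hD hE, vmul_queerField _ _ hE hD, add_comm t s,
    ksign_eq_one, ksign_eq_one, one_smul, one_smul, map_sub]

/-- The index is chosen so that the coefficient has parity 0; its restriction to $\xi = 0$ recovers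
$D_j$, which gives injectivity. -/
theorem bodyRes_queerField (s : ZMod 2) (D : VField K n 0) (j : Fin n) :
    bodyRes K n (queerField K n s D (if s = 0 then .inl j else .inr j)) = D (.inl j) := by
  rcases zmod_two_cases s with rfl | rfl <;>
    simp [queerField_apply, varPar, varIdx, one_add_one_zmod, bodyRes_queerLift]

theorem queerField_injective (s : ZMod 2) : Function.Injective (queerField K n s) := by
  intro D E h
  ext1 j
  rcases j with j | j
  · rw [← bodyRes_queerField s D, h, bodyRes_queerField]
  · exact j.elim0

theorem queerField_partialField (s : ZMod 2) (i : Fin n) :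
    queerField K n s (partialField K (.inl i)) =
      partialField K (if s = 0 then .inl i else .inr i) := by
  -- The constant 1 lifts to 1, which has no odd part.
  have h1 : ∀ t, queerLift K n t dpOne = if t = 0 then dpOne else 0 := by
    intro t
    ext ⟨α, S⟩
    have h2 : (0 : Fin n → ℕ) = α + indExp S ↔ 0 = α ∧ ∅ = S := by
      constructor
      · intro h
        have h3 : ∀ k, α k = 0 ∧ indExp S k = 0 := fun k => by
          have := congrFun h k
          simp only [Pi.zero_apply, Pi.add_apply] at this
          omega
        refine ⟨funext fun k => (h3 k).1.symm, ?_⟩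
        ext k
        simpa [indExp] using (h3 k).2
      · rintro ⟨rfl, rfl⟩
        ext k
        simp [indExp]
    rw [queerLift_apply, dpOne, Finsupp.single_apply]
    simp only [Prod.mk.injEq, and_true, h2]
    by_cases h : 0 = α ∧ ∅ = S
    · obtain ⟨rfl, rfl⟩ := h
      by_cases ht : t = 0
      · simp [ht, dpOne]
      · simp [ht, Ne.symm ht]
    · by_cases ht : t = 0 <;> simp [h, ht, dpOne]
  ext1 k
  rw [queerField_apply]
  by_cases hk : varIdx k = i
  · subst hk
    rcases zmod_two_cases s with rfl | rfl <;> rcases k with k | k <;>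
      simp [partialField, h1, varPar, varIdx, one_add_one_zmod]
  · have hk' : k ≠ if s = 0 then .inl i else .inr i := by
      rintro rfl
      apply hk
      split_ifs <;> rfl
    rw [partialField, partialField, Pi.single_eq_of_ne hk',
      Pi.single_eq_of_ne (fun e => hk (Sum.inl.inj e)), map_zero]

theorem queerField_mem_prolong [CharP K 2] (s : ZMod 2) {D : VField K n 0}
    (hD : ∀ i, D i ∈ dpShear K n 0 2 (fun _ => 1)) :
    queerField K n s D ∈ prolong (queerImage K n) s := by
  -- The prolong is a sum of homogeneous components, so $D$ is split into fields
  -- $c\,z^{(\alpha)}\partial_{z_i}$, each of degree $|\alpha| - 1 \ge -1$.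
  rw [← Finset.univ_sum_single D, map_sum]
  refine Submodule.sum_mem _ fun i _ => ?_
  generalize D i = f, hD i = hf
  induction f, hf using dpShear_induction with
  | h0 => simp
  | hadd f g _ _ h₁ h₂ =>
    rw [Pi.single_add, map_add]
    exact Submodule.add_mem _ h₁ h₂
  | hs x c hx =>
    have hx0 : 0 ≤ monDeg x := by unfold monDeg; positivity
    refine mem_prolong_queerImage_of_mem_deg (queerField_mem_par s _)
      (queerField_mem_swapInv s fun j => ?_) (k := monDeg x - 1) (by omega)
      (queerField_mem_deg s (mem_vDeg.2 fun j => ?_))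
    · by_cases h : j = i
      · subst h
        rw [Pi.single_eq_same]
        exact Finsupp.single_mem_supported K c hx
      · rw [Pi.single_eq_of_ne h]
        exact Submodule.zero_mem _
    · by_cases h : j = i
      · subst h
        rw [Pi.single_eq_same]
        exact Finsupp.single_mem_supported K c (by simp)
      · rw [Pi.single_eq_of_ne h]
        exact Submodule.zero_mem _

/-- For each $j$, the coefficients at $z_j$ and $\xi_j$, labelled by their parities, form a
Cauchy–Riemann pair. The field $D$ collects the restrictions of their even parts, and uniqueness
shows that its lift is $X$. -/
theorem exists_queerField_eq [CharP K 2] {s : ZMod 2} {X : VField K n n}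
    (hp : X ∈ vPar K n n s) (hs : X ∈ swapInv K n) :
    ∃ D : VField K n 0, (∀ i, D i ∈ dpShear K n 0 2 (fun _ => 1)) ∧ queerField K n s D = X := by
  let G : Fin n → ZMod 2 → DPow K n n := fun j t => if t = s then X (.inl j) else X (.inr j)
  have hG : ∀ j, IsQueer (G j) := by
    intro j
    refine ⟨fun t => ?_, fun t i => ?_⟩
    · by_cases h : t = s
      · subst h
        simpa [G, varPar] using mem_vPar.1 hp (.inl j)
      · have h1 : t = s + 1 := eq_add_one_of_ne_zmod h
        simpa [G, h, ← h1, varPar] using mem_vPar.1 hp (.inr j)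
    · by_cases h : t = s
      · subst h
        simpa [G] using (hs (.inl i) (.inl j)).symm
      · have h1 : t + 1 = s := by rw [eq_add_one_of_ne_zmod h, add_one_add_one_zmod]
        simpa [G, h, h1] using (hs (.inl i) (.inr j)).symm
  refine ⟨fun k => Sum.elim (fun j => bodyRes K n (G j 0)) (fun j => j.elim0) k, ?_, ?_⟩
  · rintro (j | j)
    · exact (hG j).bodyRes_mem_shear
    · exact j.elim0
  · ext1 k
    rw [queerField_apply, Sum.elim_inl, (isQueer_queerLift (hG _).bodyRes_mem_shear).ext (hG _)
      (bodyRes_queerLift _)]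
    rcases k with k | k <;> simp [G, varPar, varIdx]

theorem exists_queerField_eq_iff [CharP K 2] {s : ZMod 2} {X : VField K n n} :
    (∃ D : vectS K n, queerField K n s D.1.1 = X) ↔ X ∈ prolong (queerImage K n) s := by
  constructor
  · rintro ⟨D, rfl⟩
    exact queerField_mem_prolong s D.2
  · intro h
    obtain ⟨hp, hs⟩ := prolong_queerImage_le n s h
    obtain ⟨D, hD, rfl⟩ := exists_queerField_eq hp hs
    refine ⟨⟨⟨D, mem_vPar.2 fun i => mem_dpPar.2 fun x hx => ?_⟩, hD⟩, rfl⟩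
    -- With no odd indeterminates every monomial has parity 0, so $D$ is automatically even.
    rcases i with i | i
    · simp [varPar, Finset.eq_empty_of_isEmpty x.2] at hx
    · exact i.elim0

/-- The embedding of `q(vect(n; N_s|0))` into `vect(n|n)`. -/
noncomputable def queerHom (K : Type*) [Field K] [CharP K 2] (n : ℕ) :
    LieSuperHom (queerification (vectSTwo K n)) (vectSuper K n n) where
  even :=
    { toFun := fun D => ⟨queerField K n 0 D.1.1, queerField_mem_par 0 _⟩
      map_add' := fun D E => Subtype.ext (map_add (queerField K n 0) D.1.1 E.1.1)
      map_smul' := fun c D => Subtype.ext (map_smul (queerField K n 0) c D.1.1)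
      map_lie' := fun {D E} => Subtype.ext (vbr_queerField 0 0 D.2 E.2).symm }
  odd :=
    { toFun := fun D => ⟨queerField K n 1 D.1.1, queerField_mem_par 1 _⟩
      map_add' := fun D E => Subtype.ext (map_add (queerField K n 1) D.1.1 E.1.1)
      map_smul' := fun c D => Subtype.ext (map_smul (queerField K n 1) c D.1.1) }
  map_lie_odd D E := Subtype.ext (vbr_queerField 0 1 D.2 E.2).symm
  map_sq D := Subtype.ext (vmul_queerField 1 1 D.2 D.2).symm
  map_oddBracket D E := Subtype.ext (vbr_queerField 1 1 D.2 E.2).symm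

end
end QProlong

open QProlong
theorem mainTheorem4 (K : Type*) [Field K] (n : ℕ) :
    (∀ _ : CharP K 2,
      ∃ φ : LieSuperHom (queerification (vectSTwo K n)) (vectSuper K n n),
        Function.Injective φ.even ∧ Function.Injective φ.odd ∧
        (∀ X : VEven K n n, X ∈ Set.range φ.even ↔ X.1 ∈ prolong (queerImage K n) 0) ∧
        (∀ X : VOdd K n n, X ∈ Set.range φ.odd ↔ X.1 ∈ prolong (queerImage K n) 1) ∧
        (∀ (k : ℤ) (D : vectS K n), D.1.1 ∈ vDeg K n 0 k →
          (φ.even D).1 ∈ vDeg K n n k ∧ (φ.odd D).1 ∈ vDeg K n n k) ∧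
        (∀ i : Fin n, (φ.even (vectPartial K i)).1 = partialField K (.inl i) ∧
          (φ.odd (vectPartial K i)).1 = partialField K (.inr i))) ∧
    (¬ CharP K 2 → ∀ (k : ℕ) (s : ZMod 2), 1 ≤ k → prolongComp (queerImage K n) k s = ⊥) := by
  constructor
  · intro _
    refine ⟨queerHom K n, fun D E h => ?_, fun D E h => ?_, fun X => ?_, fun X => ?_,
      fun k D hD => ⟨queerField_mem_deg 0 hD, queerField_mem_deg 1 hD⟩,
      fun i => ⟨queerField_partialField 0 i, queerField_partialField 1 i⟩⟩
    · exact Subtype.ext (Subtype.ext (queerField_injective 0 (congrArg Subtype.val h)))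
    · exact Subtype.ext (Subtype.ext (queerField_injective 1 (congrArg Subtype.val h)))
    · rw [← exists_queerField_eq_iff]
      exact exists_congr fun D => Subtype.ext_iff
    · rw [← exists_queerField_eq_iff]
      exact exists_congr fun D => Subtype.ext_iff
  · intro h k s hk
    obtain ⟨k, rfl⟩ := Nat.exists_eq_add_of_le' hk
    -- In a field, $2 = 0$ would force characteristic 2.
    refine prolongComp_queerImage_eq_bot (fun h2 => h ?_) n k s
    exact CharTwo.of_one_ne_zero_of_two_eq_zero one_ne_zero h2
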